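/- Let $p\ge 1$, let $\Gamma\subset\mathbb R^3$ be an embedded surface without boundary of class $C^{p+1}$, and let $K\subseteq\Gamma$ be compact (for compact $\Gamma$ one may take $K=\Gamma$). Fix constants $C_0,\rho,\kappa\in\mathbb R$, $k_0\in\mathbb N$ and an exponent $r\in[1,\infty]$. Then there are constants $C$ and $h_0>0$, depending only on these data, such that the following holds for every $h\in(0,h_0]$. Consider a finite triangle mesh with vertices $x_a\in\mathbb R^3$ whose edges have length at most $\rho h$. For each vertex $a$ let there be given: an orthonormal frame $Q_a=[s_a,t_a,m_a]$, a normal $n_a\in\mathbb R^3$, a stencil $S_a$ contained in the $k_0$-ring of $a$ (the $0$-ring is $a$ itself; the $(k+1)$-ring consists of the vertices of all triangles incident on vertices of the $k$-ring), and weights $\omega_{a,i}\ge 0$ ($i\in S_a$). Assume that for each $a$ there is a point $y\in K$ with $\|x_a-y\|\le C_0h^{p+1}$, $\|n_a-\nu\|\le C_0h^{p}$ and $\|m_a-\nu'\|\le C_0h$ for some unit normals $\nu,\nu'$ of $\Gamma$ at $y$ (of either sign). For $i\in S_a$ let $(u_i,v_i,f_i)^T=Q_a^T(x_i-x_a)$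 and $(\alpha_i,\beta_i,\gamma_i)^T=Q_a^Tn_i$. The degree-$p$ Hermite-style fitting at $a$ is a polynomial $\tilde f_a(u,v)=\sum_{j+k\le p}c_{jk}u^jv^k$ whose coefficient vector $c$ minimizes $\|\Omega D(Uc-f)\|_2$. Here the rows of the system $Uc\approx f$ are, for each $i\in S_a$, the three equations $$\sum c_{jk}u_i^jv_i^k\approx f_i,\qquad \sum c_{jk}\,j\,u_i^{j-1}v_i^k\approx-\alpha_i/\gamma_i,\qquad \sum c_{jk}\,k\,u_i^jv_i^{k-1}\approx-\beta_i/\gamma_i;$$ $\Omega$ is diagonal and multiplies each of the three rows of $i$ by $\omega_{a,i}$; and $D$ is diagonal and multiplies the first kind of row by $1$ and the other two kinds by $h$. Assume that the rescaled Vandermonde systems are well conditioned: with $V=DUT$ and $T=\operatorname{diag}(h^{-j-k})$, the matrix $A=\Omega V$ of each vertex has full column rank and $\|A\|_r\,\|A^+\|_r\le\kappa$, where $A^+=(A^TA)^{-1}A^T$ and $\|\cdot\|_r$ is the operator norm for the $\ell^r$ norms. For a point $x=\sum_{j=1}^3\xi_jx_{a_j}$ of a triangle of the mesh with vertices $a_1,a_2,a_3$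 and barycentric coordinates $\xi_j\ge0$, $\sum_j\xi_j=1$, let $q_j=x_{a_j}+Q_{a_j}\,(u,v,\tilde f_{a_j}(u,v))^T$, where $(u,v)$ are the first two coordinates of $Q_{a_j}^T(x-x_{a_j})$. The point $q=\sum_{j=1}^3\xi_jq_j$ is the H-WALF reconstruction of $x$. Then every point $q$ of the H-WALF reconstruction has a closest point $y^*$ on $\Gamma$, and $$\operatorname{dist}(q,\Gamma)=\|q-y^*\|\le C\,(h^{p+1}+h^6).$$ -/

import Mathlib

open scoped ENNReal

noncomputable section

/-- Euclidean space `ℝ³`. -/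
abbrev E3 : Type := EuclideanSpace ℝ (Fin 3)

/-! ### Surfaces -/

/-- `Γ ⊆ ℝ³` is an embedded surface (without boundary) of class `C^k`: near each of its points it
is the zero set of a `C^k` function whose derivative does not vanish. -/
def IsRegularSurface (k : ℕ) (Γ : Set E3) : Prop :=
  ∀ x ∈ Γ, ∃ (U : Set E3) (F : E3 → ℝ), IsOpen U ∧ x ∈ U ∧ ContDiffOn ℝ k F U ∧
    (∀ y ∈ U, fderiv ℝ F y ≠ 0) ∧ ∀ y ∈ U, (y ∈ Γ ↔ F y = 0)

/-- `ν` is one of the two unit normals of `Γ` at `x`: a unit vector orthogonal to all tangent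
directions of `Γ` at `x`. -/
def IsUnitNormal (Γ : Set E3) (x ν : E3) : Prop :=
  ‖ν‖ = 1 ∧ ∀ τ ∈ tangentConeAt ℝ Γ x, inner ℝ ν τ = 0

/-! ### Triangle meshes -/

/-- A triangle mesh in `ℝ³`: finitely many vertices with their positions, and triangles given by
their three vertices. -/
structure TriMesh where
  /-- the number of vertices -/
  numVerts : ℕ
  /-- the positions of the vertices -/
  pos : Fin numVerts → E3
  /-- the triangles -/
  faces : Finset (Finset (Fin numVerts))
  card_face : ∀ T ∈ faces, T.card = 3

/-- The vertices of the 1-ring of `v`, that is, of the triangles incident on `v`. -/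
def TriMesh.oneRing (M : TriMesh) (v : Fin M.numVerts) : Finset (Fin M.numVerts) :=
  (M.faces.filter (fun T => v ∈ T)).biUnion id

/-- The vertices of the `k`-ring of `v`: the `(k+1)`-ring is the union of the 1-rings of the
vertices of the `k`-ring (and the 0-ring is `v` alone). -/
def TriMesh.ring (M : TriMesh) : ℕ → Fin M.numVerts → Finset (Fin M.numVerts)
  | 0, v => {v}
  | k + 1, v => (TriMesh.ring M k v).biUnion M.oneRing

/-! ### Condition numbers -/

/-- The operator norm of a real matrix with respect to the `ℓ^r` norms. -/
def matrixLpNorm (r : ℝ≥0∞) [Fact (1 ≤ r)] {m n : Type} [Fintype m] [Fintype n] [DecidableEq n]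
    (A : Matrix m n ℝ) : ℝ :=
  ‖LinearMap.toContinuousLinearMap (Matrix.toLpLin r r A)‖

/-- The pseudoinverse `A⁺ = (AᵀA)⁻¹Aᵀ` of a matrix of full column rank. -/
def pseudoinverse {m n : Type} [Fintype m] [Fintype n] [DecidableEq n]
    (A : Matrix m n ℝ) : Matrix n m ℝ :=
  (A.transpose * A)⁻¹ * A.transpose

/-- `A` has full column rank, and its condition number `‖A‖ ‖A⁺‖` in the `ℓ^r` norm is at most
`κ`. -/
def IsWellConditioned (r : ℝ≥0∞) [Fact (1 ≤ r)] (κ : ℝ) {m n : Type} [Fintype m] [DecidableEq m]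
    [Fintype n] [DecidableEq n] (A : Matrix m n ℝ) : Prop :=
  Function.Injective A.mulVec ∧ matrixLpNorm r A * matrixLpNorm r (pseudoinverse A) ≤ κ

/-! ### Hermite-style fittings and the H-WALF reconstruction -/

/-- The exponents `(j, k)`, `j + k ≤ p`, of the monomials `u ^ j * v ^ k` of degree at most `p`. -/
abbrev MonoIdx (p : ℕ) : Type := {a : Fin (p + 1) × Fin (p + 1) // a.1.val + a.2.val ≤ p}

/-- The value at `(u, v)` of the polynomial with coefficients `c`. -/
def evalPoly {p : ℕ} (c : MonoIdx p → ℝ) (u v : ℝ) : ℝ :=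
  ∑ a : MonoIdx p, c a * u ^ a.1.1.val * v ^ a.1.2.val

/-- The data at the vertices of a mesh from which the Hermite-style fittings are computed. -/
structure HermiteData (M : TriMesh) where
  /-- the axes `s, t, m` (components `0, 1, 2`) of the local frame at each vertex; `m` is the
  approximate normal that the frame is built on -/
  frame : Fin M.numVerts → OrthonormalBasis (Fin 3) ℝ E3
  /-- the accurate normals used in the fittings -/
  normal : Fin M.numVerts → E3
  /-- the stencil of each vertex -/
  stencil : Fin M.numVerts → Finset (Fin M.numVerts)
  /-- `weight v i` is the weight of the vertex `i` in the fitting at `v` -/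
  weight : Fin M.numVerts → Fin M.numVerts → ℝ

namespace HermiteData

variable {M : TriMesh} (D : HermiteData M)

/-- The coordinates `Qᵀ (x - x_v)` of the point `x` in the local frame at the vertex `v`. -/
def coord (v : Fin M.numVerts) (x : E3) : E3 := (D.frame v).repr (x - M.pos v)

/-- The rows of the fitting system at `v`: three for each point of the stencil, one for the
height (block `0`) and one for each partial derivative of the height (blocks `1` and `2`). -/
abbrev Row (v : Fin M.numVerts) : Type := Fin 3 × {i // i ∈ D.stencil v}

/-- The matrix `U` of the unscaled Hermite fitting system of degree `p` at `v`. -/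
def fitMatrix (p : ℕ) (v : Fin M.numVerts) : Matrix (D.Row v) (MonoIdx p) ℝ :=
  Matrix.of fun row a =>
    let x : E3 := D.coord v (M.pos row.2)
    let j : ℕ := a.1.1.val
    let k : ℕ := a.1.2.val
    ![x 0 ^ j * x 1 ^ k, j * x 0 ^ (j - 1) * x 1 ^ k, k * x 0 ^ j * x 1 ^ (k - 1)] row.1

/-- The right-hand side `f` of that system: the heights `f_i` and the slopes `-α_i / γ_i`,
`-β_i / γ_i`, where `(α_i, β_i, γ_i)` is the normal at the vertex `i` in the local frame at `v`. -/
def fitRhs (v : Fin M.numVerts) : D.Row v → ℝ := fun row =>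
  let n : E3 := (D.frame v).repr (D.normal row.2)
  ![D.coord v (M.pos row.2) 2, -(n 0 / n 2), -(n 1 / n 2)] row.1

/-- The matrix `D = diag(I, h I, h I)`. -/
def rowScaling (h : ℝ) (v : Fin M.numVerts) : Matrix (D.Row v) (D.Row v) ℝ :=
  Matrix.diagonal fun row => ![1, h, h] row.1

/-- The matrix `T`, diagonal with entries `h ^ (-j-k)`. -/
def colScaling (h : ℝ) (p : ℕ) : Matrix (MonoIdx p) (MonoIdx p) ℝ :=
  Matrix.diagonal fun a => (h ^ (a.1.1.val + a.1.2.val))⁻¹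

/-- The weighting matrix `Ω = diag(W, W, W)`. -/
def weightMatrix (v : Fin M.numVerts) : Matrix (D.Row v) (D.Row v) ℝ :=
  Matrix.diagonal fun row => D.weight v row.2

/-- The rescaled Vandermonde matrix `V = D U T`. -/
def rescaledMatrix (p : ℕ) (h : ℝ) (v : Fin M.numVerts) : Matrix (D.Row v) (MonoIdx p) ℝ :=
  D.rowScaling h v * D.fitMatrix p v * colScaling h p

/-- The weighted residual `‖Ω D (U c - f)‖₂` of the coefficients `c`. -/
def residual {p : ℕ} (h : ℝ) (v : Fin M.numVerts) (c : MonoIdx p → ℝ) : ℝ :=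
  ‖WithLp.toLp 2
    ((D.weightMatrix v * D.rowScaling h v).mulVec ((D.fitMatrix p v).mulVec c - D.fitRhs v))‖

/-- `c` is a solution of the weighted least-squares problem of degree `p` at `v`. -/
def IsFit {p : ℕ} (h : ℝ) (v : Fin M.numVerts) (c : MonoIdx p → ℝ) : Prop :=
  ∀ c' : MonoIdx p → ℝ, D.residual h v c ≤ D.residual h v c'

/-- The point obtained for `x` from the fitting at `v` with coefficients `c`: it has the same
`uv`-coordinates as `x` in the local frame at `v`, and its height is that of the fitted
polynomial. -/
def localPoint {p : ℕ} (v : Fin M.numVerts) (c : MonoIdx p → ℝ) (x : E3) : E3 :=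
  M.pos v + (D.frame v).repr.symm
    !₂[D.coord v x 0, D.coord v x 1, evalPoly c (D.coord v x 0) (D.coord v x 1)]

/-- The H-WALF reconstructed surface, from the coefficients `c v` of the fittings at the vertices:
each point `∑ ξ_v x_v` of a triangle, with barycentric coordinates `ξ`, is replaced with the average
with weights `ξ_v` of the points obtained for it from the fittings at the vertices of the
triangle. -/
def hwalfSurface {p : ℕ} (c : Fin M.numVerts → MonoIdx p → ℝ) : Set E3 :=
  {q | ∃ T ∈ M.faces, ∃ ξ : Fin M.numVerts → ℝ, (∀ v ∈ T, 0 ≤ ξ v) ∧ ∑ v ∈ T, ξ v = 1 ∧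
    q = ∑ v ∈ T, ξ v • D.localPoint v (c v) (∑ w ∈ T, ξ w • M.pos w)}

end HermiteData

end

noncomputable section

open Filter Topology Asymptotics

/-! Write p = n + 1. Near a vertex x the surface is a graph over the plane of the first two frame
axes. The implicit function theorem, with x and the frame as parameters, makes the height jointly of
class C^(p+1). Taylor's theorem with parameters and compactness of K then give one radius and one
constant for all admissible vertices and frames (`exists_uniform_isGraphModel`): a polynomial of
degree p describes the heights to order p + 1 and the slopes to order p.

Local fits: inserted into the fitting system, the Taylor coefficients leave residuals O(h^(p+1)) in
the rows scaled by D (`exists_row_bounds`). The rescaled deviation of the fit from them is A⁺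
applied to the weighted residual. The column of A for the constant monomial holds the weights in the
height rows and zeros elsewhere, so the norm of the weighted residual is O(h^(p+1)) ‖A‖, and the
deviation is O(κ h^(p+1)) for any number of rows (`HermiteData.abs_coeff_sub_le`). Hence each local
point q_j is within O(h^(p+1)) of Γ.

Averaging: a convex combination of points near a curved surface leaves it by an amount quadratic in
their diameter. Here q_j = X + t_j m_j, with X in the flat triangle. The height of X above the
surface is O(h^2), and the axes m_j agree up to sign and O(h). So t_j = O(h^2), the sideways
displacements are O(h^3), and the q_j lie within O(h^(p+1) + h^3) of each other
(`norm_add_smul_sub_le`). Squaring produces the term h^6 (`exists_average_bound`).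

Since Γ need not be closed, the existence of a closest point is a separate matter, settled by local
compactness (`exists_isCompact_inter_closedBall`). -/

/-! ### Polynomials in two variables -/

/-- The polynomial of degree at most `n` in two variables with coefficients `c j k`. -/
def polyEval (n : ℕ) (c : ℕ → ℕ → ℝ) (u v : ℝ) : ℝ :=
  ∑ j ∈ Finset.range (n + 1), ∑ k ∈ Finset.range (n + 1 - j), c j k * u ^ j * v ^ k

theorem sum_monoIdx (p : ℕ) (f : ℕ → ℕ → ℝ) :
    ∑ a : MonoIdx p, f a.1.1.val a.1.2.val =
      ∑ j ∈ Finset.range (p + 1), ∑ k ∈ Finset.range (p + 1 - j), f j k := by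
  have h1 := Finset.sum_subtype (F := inferInstance) (p := fun a : Fin (p + 1) × Fin (p + 1) =>
    a.1.val + a.2.val ≤ p) (Finset.univ.filter fun a => a.1.val + a.2.val ≤ p) (by simp)
    (fun a => f a.1.val a.2.val)
  rw [← h1, Finset.sum_filter, Fintype.sum_prod_type, ← Fin.sum_univ_eq_sum_range
    (fun j => ∑ k ∈ Finset.range (p + 1 - j), f j k)]
  refine Finset.sum_congr rfl fun j _ => ?_
  rw [Fin.sum_univ_eq_sum_range (fun k => if j.val + k ≤ p then f j k else 0),
    ← Finset.sum_filter]
  refine Finset.sum_congr ?_ fun _ _ => rfl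
  ext k
  simp only [Finset.mem_filter, Finset.mem_range]
  omega

theorem polyEval_zero_right (n : ℕ) (c : ℕ → ℕ → ℝ) : polyEval n c 0 0 = c 0 0 := by
  unfold polyEval
  rw [Finset.sum_eq_single 0, Finset.sum_eq_single 0] <;> simp +contextual

/-- The factor `j` kills the terms in which the exponent `j - 1` truncates; shifting `j` leaves a
triangle of indices one smaller. The same sum appears in the slope rows of the fitting matrix. -/
theorem sum_mul_deriv_pow_left (n : ℕ) (c : ℕ → ℕ → ℝ) (u v : ℝ) :
    ∑ j ∈ Finset.range (n + 1 + 1), ∑ k ∈ Finset.range (n + 1 + 1 - j),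
      c j k * j * u ^ (j - 1) * v ^ k = polyEval n (fun j k => (j + 1) * c (j + 1) k) u v := by
  unfold polyEval
  rw [Finset.sum_range_succ' _ (n + 1)]
  simp only [Nat.cast_zero, mul_zero, zero_mul, Finset.sum_const_zero, add_zero,
    Nat.add_sub_cancel, Nat.add_sub_add_right]
  refine Finset.sum_congr rfl fun j _ => Finset.sum_congr rfl fun k _ => ?_
  push_cast; ring

theorem sum_mul_deriv_pow_right (n : ℕ) (c : ℕ → ℕ → ℝ) (u v : ℝ) :
    ∑ j ∈ Finset.range (n + 1 + 1), ∑ k ∈ Finset.range (n + 1 + 1 - j),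
      c j k * k * u ^ j * v ^ (k - 1) = polyEval n (fun j k => (k + 1) * c j (k + 1)) u v := by
  unfold polyEval
  rw [Finset.sum_range_succ _ (n + 1)]
  simp only [Nat.add_sub_cancel_left, Finset.sum_range_one, Nat.cast_zero, mul_zero, zero_mul,
    add_zero]
  refine Finset.sum_congr rfl fun j hj => ?_
  have : n + 1 + 1 - j = (n + 1 - j) + 1 := by have := Finset.mem_range.1 hj; omega
  rw [this, Finset.sum_range_succ' _ (n + 1 - j)]
  simp only [Nat.cast_zero, mul_zero, zero_mul, add_zero, Nat.add_sub_cancel]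
  refine Finset.sum_congr rfl fun k _ => ?_
  push_cast; ring

theorem hasFDerivAt_polyEval (n : ℕ) (c : ℕ → ℕ → ℝ) (w : ℝ × ℝ) :
    HasFDerivAt (fun w : ℝ × ℝ => polyEval (n + 1) c w.1 w.2)
      (polyEval n (fun j k => (j + 1) * c (j + 1) k) w.1 w.2 • ContinuousLinearMap.fst ℝ ℝ ℝ +
        polyEval n (fun j k => (k + 1) * c j (k + 1)) w.1 w.2 • ContinuousLinearMap.snd ℝ ℝ ℝ)
      w := by
  have h1 : HasFDerivAt (fun w : ℝ × ℝ => polyEval (n + 1) c w.1 w.2)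
      (∑ j ∈ Finset.range (n + 1 + 1), ∑ k ∈ Finset.range (n + 1 + 1 - j),
        ((c j k * j * w.1 ^ (j - 1) * w.2 ^ k) • ContinuousLinearMap.fst ℝ ℝ ℝ +
        (c j k * k * w.1 ^ j * w.2 ^ (k - 1)) • ContinuousLinearMap.snd ℝ ℝ ℝ)) w := by
    unfold polyEval
    refine HasFDerivAt.fun_sum fun j _ => HasFDerivAt.fun_sum fun k _ => ?_
    have hu : HasFDerivAt (fun w : ℝ × ℝ => w.1 ^ j) _ w :=
      (hasFDerivAt_fst (𝕜 := ℝ) (p := w)).pow j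
    have hv : HasFDerivAt (fun w : ℝ × ℝ => w.2 ^ k) _ w :=
      (hasFDerivAt_snd (𝕜 := ℝ) (p := w)).pow k
    refine ((hu.const_mul (c j k)).mul hv).congr_fderiv ?_
    ext <;> simp <;> ring
  refine h1.congr_fderiv (Eq.symm ?_)
  simp only [Finset.sum_add_distrib, ← Finset.sum_smul, sum_mul_deriv_pow_left,
    sum_mul_deriv_pow_right]

/-! ### Taylor expansion in two variables, uniformly in parameters -/

section Taylor

variable {Θ : Type*} [NormedAddCommGroup Θ] [NormedSpace ℝ Θ]

/-- The partial derivative in the first of the two real variables. -/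
def partialU (g : Θ × ℝ × ℝ → ℝ) (z : Θ × ℝ × ℝ) : ℝ := fderiv ℝ g z (0, 1, 0)

/-- The partial derivative in the second of the two real variables. -/
def partialV (g : Θ × ℝ × ℝ → ℝ) (z : Θ × ℝ × ℝ) : ℝ := fderiv ℝ g z (0, 0, 1)

/-- The Taylor coefficients at `(θ, 0, 0)` in the two real variables. -/
def taylorCoeff (g : Θ × ℝ × ℝ → ℝ) (θ : Θ) (j k : ℕ) : ℝ :=
  partialU^[j] (partialV^[k] g) (θ, 0, 0) / (j.factorial * k.factorial)

theorem ContDiffAt.partialU {n : ℕ} {g : Θ × ℝ × ℝ → ℝ} {z : Θ × ℝ × ℝ}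
    (hg : ContDiffAt ℝ (n + 1 : ℕ) g z) : ContDiffAt ℝ n (partialU g) z :=
  (hg.fderiv_right (m := n) (by norm_cast)).clm_apply contDiffAt_const

theorem ContDiffAt.partialV {n : ℕ} {g : Θ × ℝ × ℝ → ℝ} {z : Θ × ℝ × ℝ}
    (hg : ContDiffAt ℝ (n + 1 : ℕ) g z) : ContDiffAt ℝ n (partialV g) z :=
  (hg.fderiv_right (m := n) (by norm_cast)).clm_apply contDiffAt_const

theorem ContDiffAt.iterate_partialU {j n : ℕ} {g : Θ × ℝ × ℝ → ℝ} {z : Θ × ℝ × ℝ}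
    (hg : ContDiffAt ℝ (n + j : ℕ) g z) : ContDiffAt ℝ n (_root_.partialU^[j] g) z := by
  induction j generalizing g with
  | zero => simpa using hg
  | succ j ih => exact ih (ContDiffAt.partialU (n := n + j) hg)

theorem ContDiffAt.iterate_partialV {j n : ℕ} {g : Θ × ℝ × ℝ → ℝ} {z : Θ × ℝ × ℝ}
    (hg : ContDiffAt ℝ (n + j : ℕ) g z) : ContDiffAt ℝ n (_root_.partialV^[j] g) z := by
  induction j generalizing g with
  | zero => simpa using hg
  | succ j ih => exact ih (ContDiffAt.partialV (n := n + j) hg)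

theorem Filter.EventuallyEq.partialU {g g' : Θ × ℝ × ℝ → ℝ} {z : Θ × ℝ × ℝ}
    (h : g =ᶠ[𝓝 z] g') : partialU g =ᶠ[𝓝 z] partialU g' :=
  (h.fderiv (𝕜 := ℝ)).mono fun y hy => by simp only [_root_.partialU, hy]

theorem Filter.EventuallyEq.partialV {g g' : Θ × ℝ × ℝ → ℝ} {z : Θ × ℝ × ℝ}
    (h : g =ᶠ[𝓝 z] g') : partialV g =ᶠ[𝓝 z] partialV g' :=
  (h.fderiv (𝕜 := ℝ)).mono fun y hy => by simp only [_root_.partialV, hy]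

theorem Filter.EventuallyEq.iterate_partialU {g g' : Θ × ℝ × ℝ → ℝ} {z : Θ × ℝ × ℝ}
    (h : g =ᶠ[𝓝 z] g') (j : ℕ) : _root_.partialU^[j] g =ᶠ[𝓝 z] _root_.partialU^[j] g' := by
  induction j generalizing g g' with
  | zero => exact h
  | succ j ih => exact ih h.partialU

theorem Filter.EventuallyEq.iterate_partialV {g g' : Θ × ℝ × ℝ → ℝ} {z : Θ × ℝ × ℝ}
    (h : g =ᶠ[𝓝 z] g') (j : ℕ) : _root_.partialV^[j] g =ᶠ[𝓝 z] _root_.partialV^[j] g' := by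
  induction j generalizing g g' with
  | zero => exact h
  | succ j ih => exact ih h.partialV

theorem partialV_partialU_comm {g : Θ × ℝ × ℝ → ℝ} {z : Θ × ℝ × ℝ}
    (hg : ContDiffAt ℝ 2 g z) : partialV (partialU g) =ᶠ[𝓝 z] partialU (partialV g) := by
  filter_upwards [hg.eventually (by simp)] with y hy
  have hd : DifferentiableAt ℝ (fderiv ℝ g) y :=
    (hy.fderiv_right (m := 1) (by norm_num)).differentiableAt one_ne_zero
  have hsymm := hy.isSymmSndFDerivAt (by simp)
  have key : ∀ a b : Θ × ℝ × ℝ,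
      fderiv ℝ (fun y => fderiv ℝ g y a) y b = fderiv ℝ (fderiv ℝ g) y b a := by
    intro a b
    rw [fderiv_clm_apply hd (differentiableAt_const a)]
    simp
  exact (key _ _).trans ((hsymm _ _).trans (key _ _).symm)

theorem iterate_partialV_partialU_comm {k : ℕ} {g : Θ × ℝ × ℝ → ℝ} {z : Θ × ℝ × ℝ}
    (hg : ContDiffAt ℝ (k + 1 : ℕ) g z) :
    partialV^[k] (partialU g) =ᶠ[𝓝 z] partialU (partialV^[k] g) := by
  induction k generalizing g with
  | zero => rfl
  | succ k ih =>
    have h2 : ContDiffAt ℝ 2 g z := hg.of_le (by norm_cast; omega)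
    exact ((partialV_partialU_comm h2).iterate_partialV k).trans (ih hg.partialV)

theorem tendsto_prod_zero {Θ : Type*} [TopologicalSpace Θ] (θ : Θ) :
    Tendsto (fun z : Θ × ℝ × ℝ => (z.1, (0 : ℝ × ℝ))) (𝓝 (θ, 0)) (𝓝 (θ, 0)) := by
  have : Continuous fun z : Θ × ℝ × ℝ => (z.1, (0 : ℝ × ℝ)) := by fun_prop
  exact this.tendsto' _ _ rfl

/-- `taylorCoeff` takes the v-derivatives first, so the additional u-derivative has to be moved past
`partialV^[k]`. This is the symmetry of second derivatives, whence the restriction to a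
neighbourhood; for `partialV` the definition suffices. -/
theorem taylorCoeff_partialU {j k : ℕ} {g : Θ × ℝ × ℝ → ℝ} {θ : Θ}
    (hg : ContDiffAt ℝ (k + 1 : ℕ) g (θ, 0)) :
    ∀ᶠ z : Θ × ℝ × ℝ in 𝓝 (θ, 0),
      taylorCoeff (partialU g) z.1 j k = (j + 1) * taylorCoeff g z.1 (j + 1) k := by
  have h := (iterate_partialV_partialU_comm hg).iterate_partialU j
  filter_upwards [(tendsto_prod_zero θ).eventually h] with z hz
  have hz' : partialU^[j] (partialV^[k] (partialU g)) (z.1, 0, 0) =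
    partialU^[j + 1] (partialV^[k] g) (z.1, 0, 0) := hz
  unfold taylorCoeff
  rw [hz', Nat.factorial_succ]
  have := Nat.factorial_ne_zero j
  have := Nat.factorial_ne_zero k
  push_cast
  field_simp

theorem taylorCoeff_partialV (j k : ℕ) (g : Θ × ℝ × ℝ → ℝ) (θ : Θ) :
    taylorCoeff (partialV g) θ j k = (k + 1) * taylorCoeff g θ j (k + 1) := by
  unfold taylorCoeff
  rw [Nat.factorial_succ, Function.iterate_succ_apply partialV]
  have := Nat.factorial_ne_zero j
  have := Nat.factorial_ne_zero k
  push_cast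
  field_simp

theorem polyEval_taylorCoeff_partialU {n : ℕ} {g : Θ × ℝ × ℝ → ℝ} {θ : Θ}
    (hg : ContDiffAt ℝ (n + 2 : ℕ) g (θ, 0)) :
    ∀ᶠ z : Θ × ℝ × ℝ in 𝓝 (θ, 0), ∀ u v, polyEval n (taylorCoeff (partialU g) z.1) u v =
      polyEval n (fun j k => (j + 1) * taylorCoeff g z.1 (j + 1) k) u v := by
  have hU : ∀ᶠ z : Θ × ℝ × ℝ in 𝓝 (θ, 0), ∀ j ∈ Finset.range (n + 1),
      ∀ k ∈ Finset.range (n + 1 - j),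
      taylorCoeff (partialU g) z.1 j k = (j + 1) * taylorCoeff g z.1 (j + 1) k := by
    refine (Filter.eventually_all_finset _).2 fun j _ =>
      (Filter.eventually_all_finset _).2 fun k hk => taylorCoeff_partialU (hg.of_le ?_)
    have := Finset.mem_range.1 hk
    norm_cast; omega
  filter_upwards [hU] with z hz u v
  exact Finset.sum_congr rfl fun j hj => Finset.sum_congr rfl fun k hk => by rw [hz j hj k hk]

theorem polyEval_taylorCoeff_partialV (n : ℕ) (g : Θ × ℝ × ℝ → ℝ) (θ : Θ) (u v : ℝ) :
    polyEval n (taylorCoeff (partialV g) θ) u v =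
      polyEval n (fun j k => (k + 1) * taylorCoeff g θ j (k + 1)) u v :=
  Finset.sum_congr rfl fun j _ => Finset.sum_congr rfl fun k _ => by rw [taylorCoeff_partialV]

/-- Integration of a bound on the gradient in the last two variables. -/
theorem isBigO_of_partial_isBigO {Θ : Type*} [NormedAddCommGroup Θ] {R A B : Θ × ℝ × ℝ → ℝ} {θ : Θ} {m : ℕ}
    (hA : A =O[𝓝 (θ, 0)] fun z => ‖z.2‖ ^ m) (hB : B =O[𝓝 (θ, 0)] fun z => ‖z.2‖ ^ m)
    (hR : ∀ᶠ z : Θ × ℝ × ℝ in 𝓝 (θ, 0), HasFDerivAt (fun w => R (z.1, w))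
      (A z • ContinuousLinearMap.fst ℝ ℝ ℝ + B z • ContinuousLinearMap.snd ℝ ℝ ℝ) z.2)
    (h0 : ∀ᶠ z : Θ × ℝ × ℝ in 𝓝 (θ, 0), R (z.1, 0) = 0) :
    R =O[𝓝 (θ, 0)] fun z => ‖z.2‖ ^ (m + 1) := by
  obtain ⟨a, ha⟩ := hA.bound
  obtain ⟨b, hb⟩ := hB.bound
  obtain ⟨ε, hε, hball⟩ := Metric.eventually_nhds_iff_ball.1 (ha.and (hb.and (hR.and h0)))
  refine IsBigO.of_bound (|a| + |b|) ?_
  filter_upwards [Metric.ball_mem_nhds _ hε] with z hz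
  have hz' : ‖z.1 - θ‖ < ε ∧ ‖z.2‖ < ε := by
    simpa [Prod.dist_eq, ← dist_eq_norm] using hz
  have hmem : ∀ w ∈ Metric.closedBall (0 : ℝ × ℝ) ‖z.2‖, (z.1, w) ∈ Metric.ball (θ, 0) ε := by
    intro w hw
    have hw' : ‖w‖ ≤ ‖z.2‖ := by simpa using hw
    rw [Metric.mem_ball, Prod.dist_eq, dist_eq_norm, dist_zero_right]
    exact max_lt hz'.1 (hw'.trans_lt hz'.2)
  have key := (convex_closedBall (0 : ℝ × ℝ) ‖z.2‖).norm_image_sub_le_of_norm_hasFDerivWithin_le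
    (f := fun w => R (z.1, w)) (C := (|a| + |b|) * ‖z.2‖ ^ m) (x := 0) (y := z.2)
    (fun w hw => ((hball _ (hmem w hw)).2.2.1).hasFDerivWithinAt) ?_ (by simp) (by simp)
  · rw [(hball _ hz).2.2.2, sub_zero, sub_zero] at key
    rw [norm_pow, norm_norm, pow_succ, ← mul_assoc]
    exact key
  · intro w hw
    have hw' : ‖w‖ ≤ ‖z.2‖ := by simpa using hw
    have h1 := (hball _ (hmem w hw)).1
    have h2 := (hball _ (hmem w hw)).2.1
    simp only [norm_pow, norm_norm] at h1 h2
    have hp : ‖w‖ ^ m ≤ ‖z.2‖ ^ m := by gcongr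
    have hp0 : 0 ≤ ‖w‖ ^ m := by positivity
    calc _ ≤ ‖A (z.1, w)‖ * 1 + ‖B (z.1, w)‖ * 1 := by
          refine (norm_add_le _ _).trans (add_le_add ?_ ?_)
          · rw [norm_smul]; gcongr; exact ContinuousLinearMap.norm_fst_le ..
          · rw [norm_smul]; gcongr; exact ContinuousLinearMap.norm_snd_le ..
      _ ≤ |a| * ‖z.2‖ ^ m + |b| * ‖z.2‖ ^ m := by
          rw [mul_one, mul_one]
          refine add_le_add (h1.trans ?_) (h2.trans ?_)
          · exact (mul_le_mul_of_nonneg_right (le_abs_self a) hp0).trans (by gcongr)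
          · exact (mul_le_mul_of_nonneg_right (le_abs_self b) hp0).trans (by gcongr)
      _ = _ := by ring

theorem hasFDerivAt_snd_of_differentiableAt {g : Θ × ℝ × ℝ → ℝ} {z : Θ × ℝ × ℝ}
    (hg : DifferentiableAt ℝ g z) :
    HasFDerivAt (fun w => g (z.1, w)) (partialU g z • ContinuousLinearMap.fst ℝ ℝ ℝ +
      partialV g z • ContinuousLinearMap.snd ℝ ℝ ℝ) z.2 := by
  have h : HasFDerivAt (fun w : ℝ × ℝ => (z.1, w)) (ContinuousLinearMap.inr ℝ Θ (ℝ × ℝ)) z.2 :=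
    hasFDerivAt_prodMk_right z.1 z.2
  have hg' : HasFDerivAt g (fderiv ℝ g z) (z.1, z.2) := hg.hasFDerivAt
  refine (hg'.comp z.2 h).congr_fderiv ?_
  ext <;> simp [partialU, partialV]

/-- **Taylor's theorem** in two variables, uniformly in the parameter. -/
theorem taylor_isBigO {n : ℕ} {g : Θ × ℝ × ℝ → ℝ} {θ : Θ}
    (hg : ContDiffAt ℝ (n + 1 : ℕ) g (θ, 0)) :
    (fun z => g z - polyEval n (taylorCoeff g z.1) z.2.1 z.2.2) =O[𝓝 (θ, 0)]
      fun z => ‖z.2‖ ^ (n + 1) := by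
  induction n generalizing g with
  | zero =>
    have hp : ∀ z : Θ × ℝ × ℝ, polyEval 0 (taylorCoeff g z.1) z.2.1 z.2.2 = g (z.1, 0) := by
      intro z
      simp [polyEval, taylorCoeff, ← Prod.zero_eq_mk]
    simp only [hp]
    have hcont : ∀ {f : Θ × ℝ × ℝ → ℝ}, ContDiffAt ℝ 0 f (θ, 0) →
        f =O[𝓝 (θ, 0)] fun z => ‖z.2‖ ^ 0 := by
      intro f hf
      simpa using hf.continuousAt.tendsto.isBigO_one ℝ
    refine isBigO_of_partial_isBigO (A := partialU g) (B := partialV g)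
      (hcont (ContDiffAt.partialU (n := 0) hg)) (hcont (ContDiffAt.partialV (n := 0) hg)) ?_ ?_
    · filter_upwards [hg.eventually (by simp)] with z hz
      exact (hasFDerivAt_snd_of_differentiableAt (hz.differentiableAt (by simp))).sub_const _
    · simp
  | succ n ih =>
    -- The partial derivatives of the remainder are the remainders of the partial derivatives, one
    -- order lower.
    refine isBigO_of_partial_isBigO (ih hg.partialU) (ih hg.partialV) ?_ ?_
    · filter_upwards [hg.eventually (by simp), polyEval_taylorCoeff_partialU hg] with z hz hUz
      have h1 := hasFDerivAt_snd_of_differentiableAt (hz.differentiableAt (by simp))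
      have h2 := hasFDerivAt_polyEval n (taylorCoeff g z.1) z.2
      refine (h1.sub h2).congr_fderiv ?_
      rw [hUz, polyEval_taylorCoeff_partialV]
      module
    · refine Eventually.of_forall fun z => ?_
      have := polyEval_zero_right (n + 1) (taylorCoeff g z.1)
      simp [this, taylorCoeff, ← Prod.zero_eq_mk]

end Taylor

/-! ### Normals and tangents of a level set -/

theorem mem_tangentConeAt_of_hasDerivAt {E : Type*} [NormedAddCommGroup E] [NormedSpace ℝ E]
    {Γ : Set E} {γ : ℝ → E} {τ : E} {t : ℝ} (hγ : HasDerivAt γ τ t)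
    (hmem : ∀ᶠ s in 𝓝 t, γ s ∈ Γ) : τ ∈ tangentConeAt ℝ Γ (γ t) := by
  have h := hγ.hasFDerivAt.hasFDerivWithinAt (s := {s | γ s ∈ Γ})
  have h1 : (1 : ℝ) ∈ tangentConeAt ℝ {s | γ s ∈ Γ} t := by
    rw [tangentConeAt_of_mem_nhds hmem]; trivial
  have h2 := h.mapsTo_tangent_cone h1
  simp only [ContinuousLinearMap.toSpanSingleton_apply, one_smul] at h2
  exact tangentConeAt_mono (Set.image_subset_iff.2 fun s hs => hs) h2

/-- The implicit function theorem parametrizes the level set by the kernel of `F'`; the image of the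
line through `τ` is a curve in Γ with velocity `τ`. -/
theorem mem_tangentConeAt_of_mem_ker {Γ : Set E3} {F : E3 → ℝ} {F' : E3 →L[ℝ] ℝ} {y τ : E3}
    (hF : HasStrictFDerivAt F F' y) (hF' : F' ≠ 0) (hy : F y = 0)
    (hΓ : ∀ᶠ z in 𝓝 y, (z ∈ Γ ↔ F z = 0)) (hτ : F' τ = 0) : τ ∈ tangentConeAt ℝ Γ y := by
  have hsurj : F'.range = ⊤ := by
    apply LinearMap.range_eq_top.2
    apply LinearMap.surjective
    exact fun h => hF' (ContinuousLinearMap.coe_injective h)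
  set g := hF.implicitFunction F F' hsurj (F y) with hg
  have hg' : HasStrictFDerivAt g F'.ker.subtypeL 0 := hF.to_implicitFunction hsurj
  have hg0 : g 0 = y := hF.implicitFunction_apply_image hsurj
  let τ' : F'.ker := ⟨τ, hτ⟩
  have hl : HasDerivAt (fun s : ℝ => s • τ') τ' 0 := by
    simpa using (hasDerivAt_id (0 : ℝ)).smul_const τ'
  have hγ : HasDerivAt (fun s : ℝ => g (s • τ')) τ 0 := by
    have : HasFDerivAt g F'.ker.subtypeL ((0 : ℝ) • τ') := by
      simpa using hg'.hasFDerivAt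
    exact this.comp_hasDerivAt 0 hl
  have h := mem_tangentConeAt_of_hasDerivAt hγ (Γ := Γ) ?_
  · simpa [hg0] using h
  · have hc : Tendsto (fun s : ℝ => g (s • τ')) (𝓝 0) (𝓝 y) := by
      simpa [hg0] using hγ.continuousAt.tendsto
    have hc' : Tendsto (fun s : ℝ => (F y, s • τ')) (𝓝 0) (𝓝 (F y, 0)) := by
      have : Continuous (fun s : ℝ => (F y, s • τ')) := by fun_prop
      exact this.tendsto' _ _ (by simp)
    filter_upwards [hc.eventually hΓ,
      hc'.eventually (hF.map_implicitFunction_eq hsurj)] with s h1 h2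
    exact h1.2 (h2.trans hy)

/-- A unit normal is orthogonal to the kernel of `F'`, so `F'` is `F' ν` times the inner product
with `ν`. -/
theorem IsUnitNormal.norm_fderiv_le {Γ : Set E3} {F : E3 → ℝ} {F' : E3 →L[ℝ] ℝ} {y ν : E3}
    (hν : IsUnitNormal Γ y ν)
    (hF : HasStrictFDerivAt F F' y) (hF' : F' ≠ 0) (hy : F y = 0)
    (hΓ : ∀ᶠ z in 𝓝 y, (z ∈ Γ ↔ F z = 0)) : ‖F'‖ ≤ |F' ν| := by
  obtain ⟨e', he'⟩ : ∃ e, F' e ≠ 0 := by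
    by_contra! h
    exact hF' (ContinuousLinearMap.ext h)
  set e := (F' e')⁻¹ • e'
  have he : F' e = 1 := by simp [e, he']
  have key : ∀ z, inner ℝ ν z = F' z * inner ℝ ν e := by
    intro z
    have := hν.2 (z - F' z • e)
      (mem_tangentConeAt_of_mem_ker hF hF' hy hΓ (by simp [he]))
    rw [inner_sub_right, inner_smul_right] at this
    linarith
  have h1 : 1 = F' ν * inner ℝ ν e := by
    rw [← key, real_inner_self_eq_norm_sq, hν.1]; norm_num
  refine F'.opNorm_le_bound (abs_nonneg _) fun z => ?_
  have h2 : F' z = F' ν * inner ℝ ν z := by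
    rw [key z]; linear_combination (F' z) * h1
  rw [h2, norm_mul, Real.norm_eq_abs]
  have := norm_inner_le_norm (𝕜 := ℝ) ν z
  rw [hν.1, one_mul] at this
  gcongr

/-! ### Polynomial models of a surface in a moving frame -/

/-- The coordinate of `z` along the `i`-th axis of the frame `b` at `x`. -/
abbrev frameCoord (x : E3) (b : Fin 3 → E3) (i : Fin 3) (z : E3) : ℝ := inner ℝ (b i) (z - x)

/-- In the frame `b` at `x`, the surface `Γ` is at distances at most `δ` the graph of a function
which agrees up to order `n + 2` with the polynomial of degree `n + 1` with coefficients `c`, with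
constant `L`. -/
structure IsGraphModel (Γ : Set E3) (n : ℕ) (δ L : ℝ) (x : E3) (b : Fin 3 → E3)
    (c : ℕ → ℕ → ℝ) : Prop where
  coeff_le : ∀ j k, j + k ≤ n + 1 → |c j k| ≤ L
  height : ∀ z ∈ Γ, ‖z - x‖ ≤ δ →
    |frameCoord x b 2 z - polyEval (n + 1) c (frameCoord x b 0 z) (frameCoord x b 1 z)| ≤
      L * ‖z - x‖ ^ (n + 2)
  exists_mem : ∀ u v, |u| ≤ δ → |v| ≤ δ → ∃ w, x + u • b 0 + v • b 1 + w • b 2 ∈ Γ ∧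
    |w - polyEval (n + 1) c u v| ≤ L * max |u| |v| ^ (n + 2)
  normal_ne : ∀ z ∈ Γ, ‖z - x‖ ≤ δ → ∀ ν, IsUnitNormal Γ z ν → 1 ≤ L * |inner ℝ (b 2) ν|
  normal_left : ∀ z ∈ Γ, ‖z - x‖ ≤ δ → ∀ ν, IsUnitNormal Γ z ν →
    |inner ℝ (b 0) ν + polyEval n (fun j k => (j + 1) * c (j + 1) k) (frameCoord x b 0 z)
      (frameCoord x b 1 z) * inner ℝ (b 2) ν| ≤ L * ‖z - x‖ ^ (n + 1)
  normal_right : ∀ z ∈ Γ, ‖z - x‖ ≤ δ → ∀ ν, IsUnitNormal Γ z ν →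
    |inner ℝ (b 1) ν + polyEval n (fun j k => (k + 1) * c j (k + 1)) (frameCoord x b 0 z)
      (frameCoord x b 1 z) * inner ℝ (b 2) ν| ≤ L * ‖z - x‖ ^ (n + 1)

theorem IsGraphModel.mono {Γ : Set E3} {n : ℕ} {δ δ' L L' : ℝ} {x : E3} {b : Fin 3 → E3}
    {c : ℕ → ℕ → ℝ} (h : IsGraphModel Γ n δ L x b c) (hδ : δ' ≤ δ) (hL : L ≤ L') :
    IsGraphModel Γ n δ' L' x b c where
  coeff_le j k hjk := (h.coeff_le j k hjk).trans hL
  height z hz hzx := (h.height z hz (hzx.trans hδ)).trans (by gcongr)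
  exists_mem u v hu hv := by
    obtain ⟨w, h1, h2⟩ := h.exists_mem u v (hu.trans hδ) (hv.trans hδ)
    exact ⟨w, h1, h2.trans (by gcongr)⟩
  normal_ne z hz hzx ν hν := (h.normal_ne z hz (hzx.trans hδ) ν hν).trans (by gcongr)
  normal_left z hz hzx ν hν := (h.normal_left z hz (hzx.trans hδ) ν hν).trans (by gcongr)
  normal_right z hz hzx ν hν := (h.normal_right z hz (hzx.trans hδ) ν hν).trans (by gcongr)

/-- The point with coordinates `(u, v, w)` in the frame `b` at `x`, for the argument
`(((x, b), (u, v)), w)`. -/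
def framePoint (z : ((E3 × (Fin 3 → E3)) × ℝ × ℝ) × ℝ) : E3 :=
  z.1.1.1 + z.1.2.1 • z.1.1.2 0 + z.1.2.2 • z.1.1.2 1 + z.2 • z.1.1.2 2

theorem contDiff_framePoint {n : ℕ∞} : ContDiff ℝ n framePoint := by
  unfold framePoint; fun_prop

/-- The implicit function theorem is applied to `F ∘ framePoint`, whose derivative in the height is
`F'(b₀ 2)`. The position and the frame are among the variables, so ψ is smooth in them too, which
later makes the Taylor constants uniform. Arbitrary triples of vectors are allowed as frames, to
keep the parameter space a normed space. -/
theorem exists_implicit_graph {n : ℕ} {Γ : Set E3} {F : E3 → ℝ} {y₀ : E3} {b₀ : Fin 3 → E3}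
    (hF : ContDiffAt ℝ (n + 2 : ℕ) F y₀) (hy₀ : F y₀ = 0)
    (hΓ : ∀ᶠ z in 𝓝 y₀, (z ∈ Γ ↔ F z = 0)) (hb : fderiv ℝ F y₀ (b₀ 2) ≠ 0) :
    ∃ ψ : (E3 × (Fin 3 → E3)) × ℝ × ℝ → ℝ, ContDiffAt ℝ (n + 2 : ℕ) ψ ((y₀, b₀), 0) ∧
      ψ ((y₀, b₀), 0) = 0 ∧
      ∀ᶠ z in 𝓝 ((((y₀, b₀), 0), 0) : ((E3 × (Fin 3 → E3)) × ℝ × ℝ) × ℝ),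
        (framePoint z ∈ Γ ↔ ψ z.1 = z.2) := by
  set z₀ : ((E3 × (Fin 3 → E3)) × ℝ × ℝ) × ℝ := (((y₀, b₀), 0), 0)
  have hz₀ : framePoint z₀ = y₀ := by simp [framePoint, z₀]
  have hn : ((n + 2 : ℕ) : WithTop ℕ∞) ≠ 0 := by norm_cast
  have hΦ : ContDiffAt ℝ (n + 2 : ℕ) (F ∘ framePoint) z₀ := by
    refine ContDiffAt.comp z₀ ?_ (contDiff_framePoint (n := (n + 2 : ℕ))).contDiffAt
    rw [hz₀]; exact hF
  have hdΦ : fderiv ℝ (F ∘ framePoint) z₀ (0, 1) = fderiv ℝ F y₀ (b₀ 2) := by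
    have hd := (contDiff_framePoint (n := 1)).contDiffAt.differentiableAt (x := z₀) (by simp)
    have hl : HasDerivAt (fun s : ℝ => framePoint (z₀ + s • (0, 1))) (b₀ 2) 0 := by
      simp only [framePoint, z₀]
      simpa using ((hasDerivAt_id (0 : ℝ)).smul_const (b₀ 2)).const_add y₀
    rw [fderiv_comp _ (by rw [hz₀]; exact hF.differentiableAt hn) hd, hz₀]
    have := hd.hasFDerivAt.hasLineDerivAt (0, 1)
    have h2 := HasDerivAt.unique this hl
    simp [h2]
  have hinv : (fderiv ℝ (F ∘ framePoint) z₀ ∘L .inr ℝ _ ℝ).IsInvertible := by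
    refine ⟨ContinuousLinearEquiv.unitsEquivAut ℝ (Units.mk0 _ hb), ?_⟩
    ext
    simp [hdΦ]
  refine ⟨hΦ.implicitFunction hn hinv, hΦ.contDiffAt_implicitFunction hn hinv,
    hΦ.implicitFunction_apply_self hn hinv, ?_⟩
  have ht : Tendsto framePoint (𝓝 z₀) (𝓝 y₀) := by
    have := (contDiff_framePoint (n := 1)).continuous.tendsto z₀
    rwa [hz₀] at this
  filter_upwards [hΦ.eventually_apply_eq_iff_implicitFunction hn hinv, ht.eventually hΓ]
    with z h1 h2
  rw [h2, ← h1]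
  simp [hz₀, hy₀]

/-- Varying `u` or `v` moves the graph point inside Γ, so `b 0 + ψ_u • b 2` and `b 1 + ψ_v • b 2`
are tangent vectors. -/
theorem eventually_normal_of_graph {Γ : Set E3} {ψ : (E3 × (Fin 3 → E3)) × ℝ × ℝ → ℝ}
    {i₀ : (E3 × (Fin 3 → E3)) × ℝ × ℝ} (hψ : ContDiffAt ℝ 1 ψ i₀)
    (hΓ : ∀ᶠ i in 𝓝 i₀, framePoint (i, ψ i) ∈ Γ) :
    ∀ᶠ i in 𝓝 i₀, ∀ ν, IsUnitNormal Γ (framePoint (i, ψ i)) ν →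
      inner ℝ (i.1.2 0) ν + partialU ψ i * inner ℝ (i.1.2 2) ν = 0 ∧
      inner ℝ (i.1.2 1) ν + partialV ψ i * inner ℝ (i.1.2 2) ν = 0 := by
  filter_upwards [hΓ.eventually_nhds, hψ.eventually (by simp)] with i h1 h2 ν hν
  have hd := (h2.differentiableAt one_ne_zero).hasFDerivAt
  have key : ∀ a : ℝ × ℝ,
      inner ℝ ν (a.1 • i.1.2 0 + a.2 • i.1.2 1 + fderiv ℝ ψ i (0, a) • i.1.2 2) = 0 := by
    intro a
    have hl : HasDerivAt (fun s : ℝ => i + s • ((0, a) : (E3 × (Fin 3 → E3)) × ℝ × ℝ)) (0, a) 0 := by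
      simpa using ((hasDerivAt_id (0 : ℝ)).smul_const
        ((0, a) : (E3 × (Fin 3 → E3)) × ℝ × ℝ)).const_add i
    have hψl : HasDerivAt (fun s : ℝ => ψ (i + s • (0, a))) (fderiv ℝ ψ i (0, a)) 0 :=
      hd.hasLineDerivAt (0, a)
    have hcurve : HasDerivAt (fun s : ℝ => framePoint (i + s • (0, a), ψ (i + s • (0, a))))
        (a.1 • i.1.2 0 + a.2 • i.1.2 1 + fderiv ℝ ψ i (0, a) • i.1.2 2) 0 := by
      have e : (fun s : ℝ => framePoint (i + s • (0, a), ψ (i + s • (0, a)))) =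
          fun s : ℝ => i.1.1 + (i.2.1 + s * a.1) • i.1.2 0 + (i.2.2 + s * a.2) • i.1.2 1 +
            ψ (i + s • (0, a)) • i.1.2 2 := by
        funext s; simp [framePoint]
      rw [e]
      have hu : ∀ p q : ℝ, HasDerivAt (fun s : ℝ => p + s * q) q 0 := fun p q => by
        simpa using ((hasDerivAt_id (0 : ℝ)).mul_const q).const_add p
      exact ((((hu _ _).smul_const _).const_add _).add ((hu _ _).smul_const _)).add
        (hψl.smul_const _)
    have ht : Tendsto (fun s : ℝ => i + s • ((0, a) : (E3 × (Fin 3 → E3)) × ℝ × ℝ)) (𝓝 0)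
        (𝓝 i) := by simpa using hl.continuousAt.tendsto
    have := mem_tangentConeAt_of_hasDerivAt hcurve (ht.eventually h1)
    simp only [zero_smul, add_zero] at this
    exact hν.2 _ this
  have k1 := key (1, 0)
  have k2 := key (0, 1)
  simp only [one_smul, zero_smul, add_zero, zero_add, inner_add_right, inner_smul_right] at k1 k2
  refine ⟨?_, ?_⟩
  · rw [real_inner_comm, real_inner_comm ν (i.1.2 2)]; exact k1
  · rw [real_inner_comm, real_inner_comm ν (i.1.2 2)]; exact k2

theorem continuousAt_taylorCoeff {Θ : Type*} [NormedAddCommGroup Θ] [NormedSpace ℝ Θ] {j k : ℕ}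
    {g : Θ × ℝ × ℝ → ℝ} {θ : Θ} (hg : ContDiffAt ℝ (j + k : ℕ) g (θ, 0)) :
    ContinuousAt (fun θ => taylorCoeff g θ j k) θ := by
  have h1 : ContDiffAt ℝ (0 : ℕ) (partialU^[j] (partialV^[k] g)) (θ, 0) :=
    ContDiffAt.iterate_partialU (n := 0)
      (ContDiffAt.iterate_partialV (n := 0 + j) (by simpa using hg))
  have h2 : ContinuousAt (fun θ : Θ => (θ, (0 : ℝ × ℝ))) θ := by fun_prop
  exact (ContinuousAt.comp (f := fun θ : Θ => (θ, (0 : ℝ × ℝ))) h1.continuousAt h2).div_const _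

theorem sum_inner_smul_add (b : OrthonormalBasis (Fin 3) ℝ E3) (z : E3) :
    (inner ℝ (b 0) z : ℝ) • b 0 + (inner ℝ (b 1) z : ℝ) • b 1 + (inner ℝ (b 2) z : ℝ) • b 2 = z := by
  have := b.sum_repr z
  simpa [Fin.sum_univ_three, b.repr_apply_apply] using this

theorem abs_inner_le_norm_of_basis (b : OrthonormalBasis (Fin 3) ℝ E3) (i : Fin 3) (z : E3) :
    |(inner ℝ (b i) z : ℝ)| ≤ ‖z‖ := by
  simpa using abs_real_inner_le_norm (b i) z

theorem exists_eventually_abs_le {α : Type*} [TopologicalSpace α] {f : α → ℝ} {x : α}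
    (h : ContinuousAt f x) : ∃ L, ∀ᶠ y in 𝓝 x, |f y| ≤ L :=
  ⟨|f x| + 1, (h.abs.eventually_lt continuousAt_const (lt_add_one _)).mono fun _ hy => hy.le⟩

/-- The model is the Taylor polynomial of the implicit height function at the parameter `(x, b)`.
Every bound holds on a neighbourhood of `((y₀, b₀), 0)`, so one radius and one constant serve all
nearby positions and frames. -/
theorem exists_isGraphModel_near {n : ℕ} {Γ : Set E3} {F : E3 → ℝ} {y₀ : E3} {b₀ : Fin 3 → E3}
    (hF : ContDiffAt ℝ (n + 2 : ℕ) F y₀) (hy₀ : F y₀ = 0)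
    (hΓ : ∀ᶠ z in 𝓝 y₀, (z ∈ Γ ↔ F z = 0)) (hb : fderiv ℝ F y₀ (b₀ 2) ≠ 0) :
    ∃ δ L : ℝ, 0 < δ ∧ ∀ (x : E3) (b : OrthonormalBasis (Fin 3) ℝ E3),
      dist (x, (b : Fin 3 → E3)) (y₀, b₀) < δ → ∃ c, IsGraphModel Γ n δ L x b c := by
  obtain ⟨ψ, hψ, hψ0, hgraph⟩ := exists_implicit_graph hF hy₀ hΓ hb
  set i₀ : (E3 × (Fin 3 → E3)) × ℝ × ℝ := ((y₀, b₀), 0) with hi₀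
  have hψ1 : ContDiffAt ℝ 1 ψ i₀ := hψ.of_le (by norm_cast; omega)
  have hmem : ∀ᶠ i in 𝓝 i₀, framePoint (i, ψ i) ∈ Γ := by
    have : Tendsto (fun i => (i, ψ i)) (𝓝 i₀) (𝓝 (i₀, 0)) := by
      have h := continuousAt_id.prodMk hψ.continuousAt
      rw [← hψ0]; exact h
    filter_upwards [this.eventually hgraph] with i hi
    exact hi.2 rfl
  have hnormal := eventually_normal_of_graph hψ1 hmem
  obtain ⟨L₁, hL₁⟩ := (taylor_isBigO (n := n + 1) hψ).bound
  obtain ⟨L₂, hL₂⟩ := (taylor_isBigO (n := n) hψ.partialU).bound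
  obtain ⟨L₃, hL₃⟩ := (taylor_isBigO (n := n) hψ.partialV).bound
  obtain ⟨L₄, hL₄⟩ := exists_eventually_abs_le
    (ContDiffAt.partialU (n := 0) (hψ.of_le (by norm_cast; omega))).continuousAt
  obtain ⟨L₅, hL₅⟩ := exists_eventually_abs_le
    (ContDiffAt.partialV (n := 0) (hψ.of_le (by norm_cast; omega))).continuousAt
  have hcoeff : ∃ L, ∀ᶠ i : (E3 × (Fin 3 → E3)) × ℝ × ℝ in 𝓝 i₀,
      ∀ j ∈ Finset.range (n + 2), ∀ k ∈ Finset.range (n + 2 - j),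
      |taylorCoeff ψ i.1 j k| ≤ L := by
    have : ∀ j k, ∃ L, j + k ≤ n + 1 →
        ∀ᶠ i : (E3 × (Fin 3 → E3)) × ℝ × ℝ in 𝓝 i₀, |taylorCoeff ψ i.1 j k| ≤ L := by
      intro j k
      by_cases hjk : j + k ≤ n + 1
      · obtain ⟨L, hL⟩ := exists_eventually_abs_le
          (continuousAt_taylorCoeff (hψ.of_le (by norm_cast; omega)) (j := j) (k := k))
        exact ⟨L, fun _ => (continuous_fst.tendsto' i₀ _ rfl).eventually hL⟩
      · exact ⟨0, fun h => absurd h hjk⟩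
    choose L hL using this
    refine ⟨∑ j ∈ Finset.range (n + 2), ∑ k ∈ Finset.range (n + 2 - j), |L j k|,
      (Filter.eventually_all_finset _).2 fun j hj =>
      (Filter.eventually_all_finset _).2 fun k hk => ?_⟩
    have hjk : j + k ≤ n + 1 := by
      have := Finset.mem_range.1 hk; have := Finset.mem_range.1 hj; omega
    filter_upwards [hL j k hjk] with i hi
    refine hi.trans ((le_abs_self _).trans ?_)
    refine (Finset.single_le_sum (f := fun k => |L j k|) (fun _ _ => abs_nonneg _) hk).trans ?_
    exact Finset.single_le_sum (f := fun j => ∑ k ∈ Finset.range (n + 2 - j), |L j k|)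
      (fun _ _ => Finset.sum_nonneg fun _ _ => abs_nonneg _) hj
  obtain ⟨L₆, hL₆⟩ := hcoeff
  obtain ⟨ε, hε, hball⟩ := Metric.eventually_nhds_iff_ball.1
    (hmem.and (hnormal.and (hL₁.and (hL₂.and (hL₃.and (hL₄.and (hL₅.and (hL₆.and
      (polyEval_taylorCoeff_partialU hψ)))))))))
  obtain ⟨ε', hε', hball'⟩ := Metric.eventually_nhds_iff_ball.1 hgraph
  set δ := min ε ε' / 2 with hδ
  have hδ0 : 0 < δ := by positivity
  have hδε : δ < ε := by have := min_le_left ε ε'; linarith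
  have hδε' : δ < ε' := by have := min_le_right ε ε'; linarith
  -- One constant dominating all the bounds; the summand 1 is the coefficient of the third component
  -- in the proof of `normal_ne`.
  set L := 1 + |L₁| + |L₂| + |L₃| + |L₄| + |L₅| + |L₆| with hL
  have a1 := abs_nonneg L₁
  have a2 := abs_nonneg L₂
  have a3 := abs_nonneg L₃
  have a4 := abs_nonneg L₄
  have a5 := abs_nonneg L₅
  have a6 := abs_nonneg L₆
  have l1 := le_abs_self L₁
  have l2 := le_abs_self L₂
  have l3 := le_abs_self L₃
  have l4 := le_abs_self L₄
  have l5 := le_abs_self L₅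
  have l6 := le_abs_self L₆
  refine ⟨δ, L, hδ0, fun x b hxb => ⟨taylorCoeff ψ (x, b), ?_⟩⟩
  have hin : ∀ u v, |u| ≤ δ → |v| ≤ δ → (((x, (b : Fin 3 → E3)), u, v) :
      (E3 × (Fin 3 → E3)) × ℝ × ℝ) ∈ Metric.ball i₀ ε := by
    intro u v hu hv
    rw [Metric.mem_ball, hi₀, Prod.dist_eq, dist_zero_right]
    exact max_lt (hxb.trans hδε) (max_lt (hu.trans_lt hδε) (hv.trans_lt hδε))
  have hpoint : ∀ z ∈ Γ, ‖z - x‖ ≤ δ →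
      framePoint (((x, (b : Fin 3 → E3)), frameCoord x b 0 z, frameCoord x b 1 z),
        ψ ((x, b), frameCoord x b 0 z, frameCoord x b 1 z)) = z ∧
      ψ ((x, b), frameCoord x b 0 z, frameCoord x b 1 z) = frameCoord x b 2 z := by
    intro z hz hzx
    have hz' : framePoint (((x, (b : Fin 3 → E3)), frameCoord x b 0 z, frameCoord x b 1 z),
        frameCoord x b 2 z) = z := by
      have := sum_inner_smul_add b (z - x)
      unfold framePoint
      rw [add_assoc, add_assoc, ← add_assoc (_ • _), this]
      abel
    have h2 : ψ ((x, b), frameCoord x b 0 z, frameCoord x b 1 z) = frameCoord x b 2 z := by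
      refine (hball' (((x, (b : Fin 3 → E3)), frameCoord x b 0 z, frameCoord x b 1 z),
        frameCoord x b 2 z) ?_).1 (by rw [hz']; exact hz)
      have hc : ∀ i, |frameCoord x b i z| < ε' := fun i =>
        ((abs_inner_le_norm_of_basis b i _).trans hzx).trans_lt hδε'
      rw [Metric.mem_ball, Prod.dist_eq, hi₀, Prod.dist_eq, dist_zero_right, dist_zero_right]
      exact max_lt (max_lt (hxb.trans hδε') (max_lt (hc 0) (hc 1))) (hc 2)
    refine ⟨?_, h2⟩
    rw [h2, hz']
  have hnorm2 : ∀ z, ‖((frameCoord x b 0 z, frameCoord x b 1 z) : ℝ × ℝ)‖ ≤ ‖z - x‖ := fun z =>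
    max_le (abs_inner_le_norm_of_basis b 0 _) (abs_inner_le_norm_of_basis b 1 _)
  have hc : ∀ z, ‖z - x‖ ≤ δ → ∀ i, |frameCoord x b i z| ≤ δ := fun z hz i =>
    (abs_inner_le_norm_of_basis b i _).trans hz
  refine ⟨?_, ?_, ?_, ?_, ?_, ?_⟩
  · intro j k hjk
    have := (hball _ (hin 0 0 (by simpa using hδ0.le) (by simpa using hδ0.le))).2.2.2.2.2.2.2.1 j
      (Finset.mem_range.2 (by omega)) k (Finset.mem_range.2 (by omega))
    exact this.trans (by linarith)
  · intro z hz hzx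
    have h1 := (hball _ (hin _ _ (hc z hzx 0) (hc z hzx 1))).2.2.1
    rw [(hpoint z hz hzx).2, Real.norm_eq_abs] at h1
    refine h1.trans ?_
    rw [norm_pow, norm_norm]
    have : L₁ ≤ L := by linarith
    have h0 := hnorm2 z
    gcongr
  · intro u v hu hv
    have h1 := hball _ (hin u v hu hv)
    refine ⟨ψ ((x, b), u, v), h1.1, h1.2.2.1.trans ?_⟩
    rw [norm_pow, norm_norm]
    have : L₁ ≤ L := by linarith
    gcongr
    rfl
  · intro z hz hzx ν hν
    have h1 := hball _ (hin _ _ (hc z hzx 0) (hc z hzx 1))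
    obtain ⟨e1, e2⟩ := h1.2.1 ν (by rw [(hpoint z hz hzx).1]; exact hν)
    have hA := h1.2.2.2.2.2.1
    have hB := h1.2.2.2.2.2.2.1
    set A := partialU ψ ((x, b), frameCoord x b 0 z, frameCoord x b 1 z)
    set B := partialV ψ ((x, b), frameCoord x b 0 z, frameCoord x b 1 z)
    simp only at e1 e2
    have hs := sum_inner_smul_add b ν
    -- The first two components of `ν` are bounded multiples of the third, so a unit vector cannot
    -- have a small third component.
    have hn : (1 : ℝ) ≤ |inner ℝ (b 0) ν| + |inner ℝ (b 1) ν| + |inner ℝ (b 2) ν| := by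
      calc (1 : ℝ) = ‖ν‖ := hν.1.symm
        _ = ‖(inner ℝ (b 0) ν : ℝ) • b 0 + (inner ℝ (b 1) ν : ℝ) • b 1
            + (inner ℝ (b 2) ν : ℝ) • b 2‖ := by rw [hs]
        _ ≤ _ := by
          refine norm_add₃_le.trans ?_
          simp [norm_smul]
    have e1' : inner ℝ (b 0) ν = -A * inner ℝ (b 2) ν := by linarith
    have e2' : inner ℝ (b 1) ν = -B * inner ℝ (b 2) ν := by linarith
    rw [e1', e2', abs_mul, abs_mul, abs_neg, abs_neg] at hn
    refine hn.trans ?_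
    have : (|A| + |B| + 1) * |inner ℝ (b 2) ν| ≤ L * |inner ℝ (b 2) ν| := by
      gcongr; linarith
    linarith
  · intro z hz hzx ν hν
    have h1 := hball _ (hin _ _ (hc z hzx 0) (hc z hzx 1))
    obtain ⟨e1, -⟩ := h1.2.1 ν (by rw [(hpoint z hz hzx).1]; exact hν)
    have h2 := h1.2.2.2.1
    rw [h1.2.2.2.2.2.2.2.2] at h2
    set A := partialU ψ ((x, b), frameCoord x b 0 z, frameCoord x b 1 z)
    simp only at e1 h2
    have hγ : |inner ℝ (b 2) ν| ≤ 1 := hν.1 ▸ abs_inner_le_norm_of_basis b 2 ν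
    set P := polyEval n _ (frameCoord x b 0 z) (frameCoord x b 1 z)
    have e : inner ℝ (b 0) ν + P * inner ℝ (b 2) ν = -((A - P) * inner ℝ (b 2) ν) := by
      linear_combination e1
    rw [e, abs_neg, abs_mul]
    refine (mul_le_of_le_one_right (abs_nonneg _) hγ).trans (h2.trans ?_)
    rw [norm_pow, norm_norm]
    have : L₂ ≤ L := by linarith
    have h0 := hnorm2 z
    gcongr
  · intro z hz hzx ν hν
    have h1 := hball _ (hin _ _ (hc z hzx 0) (hc z hzx 1))
    obtain ⟨-, e1⟩ := h1.2.1 ν (by rw [(hpoint z hz hzx).1]; exact hν)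
    have h2 := h1.2.2.2.2.1
    rw [polyEval_taylorCoeff_partialV] at h2
    set A := partialV ψ ((x, b), frameCoord x b 0 z, frameCoord x b 1 z)
    simp only at e1 h2
    have hγ : |inner ℝ (b 2) ν| ≤ 1 := hν.1 ▸ abs_inner_le_norm_of_basis b 2 ν
    set P := polyEval n _ (frameCoord x b 0 z) (frameCoord x b 1 z)
    have e : inner ℝ (b 1) ν + P * inner ℝ (b 2) ν = -((A - P) * inner ℝ (b 2) ν) := by
      linear_combination e1
    rw [e, abs_neg, abs_mul]
    refine (mul_le_of_le_one_right (abs_nonneg _) hγ).trans (h2.trans ?_)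
    rw [norm_pow, norm_norm]
    have : L₃ ≤ L := by linarith
    have h0 := hnorm2 z
    gcongr

/-- Near a point of the surface and a frame whose third axis is tangent to the surface, there are
no frames whose third axis is close to a normal. -/
theorem exists_no_normal_near {Γ : Set E3} {F : E3 → ℝ} {y₀ : E3} {b₀ : Fin 3 → E3}
    (hF : ContDiffAt ℝ 1 F y₀) (hF' : fderiv ℝ F y₀ ≠ 0)
    (hΓ : ∀ᶠ z in 𝓝 y₀, (z ∈ Γ ↔ F z = 0)) (hb : fderiv ℝ F y₀ (b₀ 2) = 0) :
    ∀ᶠ θ : E3 × (Fin 3 → E3) in 𝓝 (y₀, b₀), θ.1 ∈ Γ → ∀ ν, IsUnitNormal Γ θ.1 ν →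
      1 / 2 < ‖θ.2 2 - ν‖ := by
  have hcont : ContinuousAt (fderiv ℝ F) y₀ := (hF.fderiv_right (m := 0) (by simp)).continuousAt
  have h1 : ContinuousAt (fun θ : E3 × (Fin 3 → E3) => fderiv ℝ F θ.1) (y₀, b₀) :=
    ContinuousAt.comp (f := Prod.fst) (x := (y₀, b₀)) hcont continuousAt_fst
  have h2 : ContinuousAt (fun θ : E3 × (Fin 3 → E3) => θ.2 2) (y₀, b₀) := by fun_prop
  have h3 : ∀ᶠ θ : E3 × (Fin 3 → E3) in 𝓝 (y₀, b₀),
      |fderiv ℝ F θ.1 (θ.2 2)| < ‖fderiv ℝ F θ.1‖ / 2 := by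
    refine (h1.clm_apply h2).abs.eventually_lt (h1.norm.div_const 2) ?_
    simp only [hb, abs_zero]
    positivity
  filter_upwards [h3, h1.eventually_ne hF', continuousAt_fst.eventually (hF.eventually (by simp)),
    continuousAt_fst.eventually hΓ.eventually_nhds] with θ hθ hne hFθ hΓθ hmem ν hν
  have h4 := hν.norm_fderiv_le (hFθ.hasStrictFDerivAt one_ne_zero) hne (hΓθ.self_of_nhds.1 hmem) hΓθ
  have h5 : |fderiv ℝ F θ.1 ν| ≤ |fderiv ℝ F θ.1 (θ.2 2)| + ‖fderiv ℝ F θ.1‖ * ‖θ.2 2 - ν‖ := by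
    have h6 := (fderiv ℝ F θ.1).le_opNorm (θ.2 2 - ν)
    rw [map_sub, Real.norm_eq_abs] at h6
    have := abs_sub_abs_le_abs_sub (fderiv ℝ F θ.1 ν) (fderiv ℝ F θ.1 (θ.2 2))
    rw [abs_sub_comm] at this
    linarith
  have hpos : 0 < ‖fderiv ℝ F θ.1‖ := norm_pos_iff.2 hne
  -- With `‖θ.2 2 - ν‖ ≤ 1 / 2`, `h5` would give |F' ν| < ‖F'‖, against `h4`.
  by_contra! hle
  nlinarith

/-! ### Uniformity of the models over a compact set -/

theorem IsRegularSurface.exists_eventually {m : ℕ} {Γ : Set E3} (hΓ : IsRegularSurface m Γ)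
    {y : E3} (hy : y ∈ Γ) : ∃ F : E3 → ℝ, ContDiffAt ℝ m F y ∧ fderiv ℝ F y ≠ 0 ∧ F y = 0 ∧
      ∀ᶠ z in 𝓝 y, (z ∈ Γ ↔ F z = 0) := by
  obtain ⟨U, F, hU, hyU, hF, hF', hUF⟩ := hΓ y hy
  exact ⟨F, hF.contDiffAt (hU.mem_nhds hyU), hF' y hyU, (hUF y hyU).1 hy,
    (hU.eventually_mem hyU).mono hUF⟩

/-- Orthonormal frames lie in a product of unit spheres, which is compact together with `K`, so it
is enough to find constants near each pair `(y₀, b₀)`. If `b₀ 2` is transversal to Γ, a model exists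
nearby; if it is tangent, no nearby frame has its third axis within 1/2 of a normal. -/
theorem exists_uniform_isGraphModel {n : ℕ} {Γ K : Set E3} (hΓ : IsRegularSurface (n + 2) Γ)
    (hK : IsCompact K) (hKΓ : K ⊆ Γ) :
    ∃ δ L : ℝ, 0 < δ ∧ ∀ y ∈ K, ∀ (x : E3) (b : OrthonormalBasis (Fin 3) ℝ E3), dist x y ≤ δ →
      (∃ ν, IsUnitNormal Γ y ν ∧ ‖b 2 - ν‖ ≤ 1 / 2) → ∃ c, IsGraphModel Γ n δ L x b c := by
  have hcpt : IsCompact (K ×ˢ Set.pi Set.univ fun _ : Fin 3 => Metric.sphere (0 : E3) 1) :=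
    hK.prod (isCompact_univ_pi fun _ => isCompact_sphere _ _)
  have key := hcpt.induction_on (p := fun s => ∃ δ L : ℝ, 0 < δ ∧ ∀ y ∈ K, ∀ (x : E3)
      (b : OrthonormalBasis (Fin 3) ℝ E3), (y, (b : Fin 3 → E3)) ∈ s → dist x y ≤ δ →
      (∃ ν, IsUnitNormal Γ y ν ∧ ‖b 2 - ν‖ ≤ 1 / 2) → ∃ c, IsGraphModel Γ n δ L x b c)
    ?_ ?_ ?_ ?_
  · obtain ⟨δ, L, hδ, h⟩ := key
    exact ⟨δ, L, hδ, fun y hy x b => h y hy x b ⟨hy, fun i _ => by simp⟩⟩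
  · exact ⟨1, 0, one_pos, by simp⟩
  · rintro s t hst ⟨δ, L, hδ, h⟩
    exact ⟨δ, L, hδ, fun y hy x b hs => h y hy x b (hst hs)⟩
  · rintro s t ⟨δ, L, hδ, h⟩ ⟨δ', L', hδ', h'⟩
    refine ⟨min δ δ', max L L', lt_min hδ hδ', ?_⟩
    rintro y hy x b (hs | ht) hxy hν
    · obtain ⟨c, hc⟩ := h y hy x b hs (hxy.trans (min_le_left _ _)) hν
      exact ⟨c, hc.mono (min_le_left _ _) (le_max_left _ _)⟩
    · obtain ⟨c, hc⟩ := h' y hy x b ht (hxy.trans (min_le_right _ _)) hν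
      exact ⟨c, hc.mono (min_le_right _ _) (le_max_right _ _)⟩
  · rintro ⟨y₀, b₀⟩ ⟨hy₀, -⟩
    obtain ⟨F, hF, hF', hFy, hFΓ⟩ := hΓ.exists_eventually (hKΓ hy₀)
    by_cases hb : fderiv ℝ F y₀ (b₀ 2) = 0
    · have := exists_no_normal_near (hF.of_le (by norm_cast; omega)) hF' hFΓ hb
      refine ⟨_, mem_nhdsWithin_of_mem_nhds this, 1, 0, one_pos, ?_⟩
      rintro y hy x b hyb - ⟨ν, hν, hle⟩
      exact absurd (hyb (hKΓ hy) ν hν) hle.not_gt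
    -- The model lives on a ball of radius δ; half of it is spent on moving from `y₀` to `y` and a
    -- third on moving from `y` to `x`.
    · obtain ⟨δ, L, hδ, h⟩ := exists_isGraphModel_near hF hFy hFΓ hb
      refine ⟨Metric.ball (y₀, b₀) (δ / 2), mem_nhdsWithin_of_mem_nhds
        (Metric.ball_mem_nhds _ (by positivity)), δ / 3, L, by positivity, ?_⟩
      intro y hy x b hyb hxy _
      have hd : dist (x, (b : Fin 3 → E3)) (y₀, b₀) < δ := by
        rw [Metric.mem_ball, Prod.dist_eq, max_lt_iff] at hyb
        rw [Prod.dist_eq]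
        refine max_lt ?_ (hyb.2.trans (half_lt_self hδ))
        have h1 : dist y y₀ < δ / 2 := hyb.1
        have h2 : dist x y₀ ≤ dist x y + dist y y₀ := dist_triangle x y y₀
        change dist x y₀ < δ
        linarith
      obtain ⟨c, hc⟩ := h x b hd
      exact ⟨c, hc.mono (by linarith) le_rfl⟩

/-! ### Closest points -/

/-- Γ need not be closed, but it is locally a zero set, hence closed in small balls; compactness of
`K` makes their radius uniform. -/
theorem exists_isCompact_inter_closedBall {m : ℕ} {Γ K : Set E3} (hΓ : IsRegularSurface m Γ)
    (hK : IsCompact K) (hKΓ : K ⊆ Γ) :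
    ∃ δ : ℝ, 0 < δ ∧ ∀ y ∈ K, IsCompact (Γ ∩ Metric.closedBall y δ) := by
  refine hK.induction_on (p := fun s => ∃ δ : ℝ, 0 < δ ∧
    ∀ y ∈ s, IsCompact (Γ ∩ Metric.closedBall y δ)) ?_ ?_ ?_ ?_
  · exact ⟨1, one_pos, by simp⟩
  · rintro s t hst ⟨δ, hδ, h⟩
    exact ⟨δ, hδ, fun y hy => h y (hst hy)⟩
  · have hle : ∀ {δ δ' : ℝ} {y : E3}, δ' ≤ δ → IsCompact (Γ ∩ Metric.closedBall y δ) →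
        IsCompact (Γ ∩ Metric.closedBall y δ') := by
      intro δ δ' y hδ h
      have := h.inter_right (Metric.isClosed_closedBall (x := y) (ε := δ'))
      rwa [Set.inter_assoc, Set.inter_eq_right.2 (Metric.closedBall_subset_closedBall hδ)] at this
    rintro s t ⟨δ, hδ, h⟩ ⟨δ', hδ', h'⟩
    refine ⟨min δ δ', lt_min hδ hδ', ?_⟩
    rintro y (hs | ht)
    · exact hle (min_le_left _ _) (h y hs)
    · exact hle (min_le_right _ _) (h' y ht)
  · intro y hy
    obtain ⟨U, F, hU, hyU, hF, -, hUF⟩ := hΓ y (hKΓ hy)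
    obtain ⟨ε, hε, hball⟩ := Metric.isOpen_iff.1 hU y hyU
    refine ⟨Metric.ball y (ε / 2), mem_nhdsWithin_of_mem_nhds
      (Metric.ball_mem_nhds _ (by positivity)), ε / 3, by positivity, fun z hz => ?_⟩
    have hsub : Metric.closedBall z (ε / 3) ⊆ U := by
      refine (Metric.closedBall_subset_ball' ?_).trans hball
      have : dist z y < ε / 2 := hz
      linarith
    have heq : Γ ∩ Metric.closedBall z (ε / 3) = Metric.closedBall z (ε / 3) ∩ F ⁻¹' {0} := by
      ext w
      constructor
      · rintro ⟨h1, h2⟩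
        exact ⟨h2, (hUF w (hsub h2)).1 h1⟩
      · rintro ⟨h1, h2⟩
        exact ⟨(hUF w (hsub h1)).2 h2, h1⟩
    rw [heq]
    refine (isCompact_closedBall z (ε / 3)).of_isClosed_subset ?_ Set.inter_subset_left
    exact (hF.continuousOn.mono hsub).preimage_isClosed_of_isClosed Metric.isClosed_closedBall
      isClosed_singleton

/-- The minimum over the compact piece is global: points of Γ outside the ball are at distance more
than δ/2 from `q`, hence farther than `y`. -/
theorem exists_dist_eq_infDist_of_isCompact_inter {X : Type*} [MetricSpace X] {Γ : Set X} {y q : X}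
    {δ : ℝ} (hcpt : IsCompact (Γ ∩ Metric.closedBall y δ)) (hy : y ∈ Γ) (hδ : 0 ≤ δ)
    (hq : dist q y ≤ δ / 2) : ∃ z ∈ Γ, dist q z = Metric.infDist q Γ := by
  obtain ⟨z, hz, hmin⟩ := hcpt.exists_infDist_eq_dist ⟨y, hy, by simpa using hδ⟩ q
  refine ⟨z, hz.1, le_antisymm ?_ (Metric.infDist_le_dist_of_mem hz.1)⟩
  have hzy : dist q z ≤ dist q y := by
    rw [← hmin]; exact Metric.infDist_le_dist_of_mem ⟨hy, by simpa using hδ⟩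
  refine (Metric.le_infDist ⟨y, hy⟩).2 fun w hw => ?_
  by_cases hwy : dist w y ≤ δ
  · rw [← hmin]; exact Metric.infDist_le_dist_of_mem ⟨hw, hwy⟩
  · have := dist_triangle w q y
    rw [dist_comm w q] at this
    linarith

/-! ### Least squares -/

section LeastSquares

variable {m n : Type} [Fintype m] [Fintype n] [DecidableEq n]

theorem Matrix.isUnit_transpose_mul_self_of_injective {A : Matrix m n ℝ}
    (hA : Function.Injective A.mulVec) : IsUnit (A.transpose * A) := by
  rw [← Matrix.mulVec_injective_iff_isUnit]
  refine (injective_iff_map_eq_zero (A.transpose * A).mulVecLin).2 fun x hx => ?_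
  have h1 : (A.transpose * A).mulVec x = 0 := hx
  have h2 : A.mulVec x ⬝ᵥ A.mulVec x = 0 := by
    rw [Matrix.dotProduct_mulVec, ← Matrix.mulVec_transpose, Matrix.mulVec_mulVec, h1]
    simp
  apply hA
  rw [dotProduct_self_eq_zero.1 h2, Matrix.mulVec_zero]

theorem Matrix.transpose_mulVec_residual {A : Matrix m n ℝ} (hA : Function.Injective A.mulVec)
    (b : m → ℝ) : A.transpose.mulVec (A.mulVec ((pseudoinverse A).mulVec b) - b) = 0 := by
  have hu := (Matrix.isUnit_iff_isUnit_det _).1 (Matrix.isUnit_transpose_mul_self_of_injective hA)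
  rw [Matrix.mulVec_sub, Matrix.mulVec_mulVec, Matrix.mulVec_mulVec, pseudoinverse,
    ← Matrix.mul_assoc, Matrix.mul_nonsing_inv _ hu, Matrix.one_mul, sub_self]

/-- The solution of a least-squares problem of full column rank is given by the pseudoinverse. -/
theorem eq_pseudoinverse_mulVec_of_forall_norm_le {A : Matrix m n ℝ}
    (hA : Function.Injective A.mulVec) {b : m → ℝ} {x : n → ℝ}
    (hx : ∀ x', ‖WithLp.toLp 2 (A.mulVec x - b)‖ ≤ ‖WithLp.toLp 2 (A.mulVec x' - b)‖) :
    x = (pseudoinverse A).mulVec b := by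
  set x' := (pseudoinverse A).mulVec b with hx'
  have hsq : ∀ y : m → ℝ, ‖WithLp.toLp 2 y‖ ^ 2 = y ⬝ᵥ y := by
    intro y
    rw [EuclideanSpace.norm_sq_eq]
    simp [dotProduct, sq]
  have h1 := pow_le_pow_left₀ (norm_nonneg _) (hx x') 2
  rw [hsq, hsq] at h1
  set d := A.mulVec (x - x') with hd
  have hsplit : A.mulVec x - b = d + (A.mulVec x' - b) := by
    rw [hd, Matrix.mulVec_sub]; abel
  -- By the normal equations the residual at `x'` is orthogonal to the range of `A`, so Pythagoras
  -- and the minimality of `x` force `d = 0`.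
  have horth : (A.mulVec x' - b) ⬝ᵥ d = 0 := by
    rw [hd, Matrix.dotProduct_mulVec, ← Matrix.mulVec_transpose,
      Matrix.transpose_mulVec_residual hA, zero_dotProduct]
  rw [hsplit, add_dotProduct, dotProduct_add, dotProduct_add, dotProduct_comm d (_ - b), horth]
    at h1
  have h2 : d ⬝ᵥ d = 0 := le_antisymm (by linarith) (by
    simpa [dotProduct] using Finset.sum_nonneg fun i _ => mul_self_nonneg (d i))
  have h3 : d = A.mulVec 0 := by rw [dotProduct_self_eq_zero.1 h2, Matrix.mulVec_zero]
  exact sub_eq_zero.1 (hA h3)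

theorem norm_toLp_mulVec_le (r : ℝ≥0∞) [Fact (1 ≤ r)] (A : Matrix m n ℝ) (x : n → ℝ) :
    ‖WithLp.toLp r (A.mulVec x)‖ ≤ matrixLpNorm r A * ‖WithLp.toLp r x‖ :=
  (LinearMap.toContinuousLinearMap (Matrix.toLpLin r r A)).le_opNorm (WithLp.toLp r x)

theorem matrixLpNorm_nonneg (r : ℝ≥0∞) [Fact (1 ≤ r)] (A : Matrix m n ℝ) :
    0 ≤ matrixLpNorm r A := norm_nonneg _

end LeastSquares

/-- A block vector whose blocks are all bounded by the first block of another one. -/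
theorem norm_toLp_le_of_forall_abs_le (r : ℝ≥0∞) [Fact (1 ≤ r)] {S : Type} [Fintype S] {η : ℝ}
    (hη : 0 ≤ η) {b a : Fin 3 × S → ℝ} (h : ∀ k i, |b (k, i)| ≤ η * |a (0, i)|) :
    ‖WithLp.toLp r b‖ ≤ 3 * η * ‖WithLp.toLp r a‖ := by
  rcases r.dichotomy with rfl | hr
  · rw [PiLp.norm_toLp, PiLp.norm_toLp]
    refine (pi_norm_le_iff_of_nonneg (by positivity)).2 fun ⟨k, i⟩ => ?_
    have h1 := norm_le_pi_norm a (0, i)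
    rw [Real.norm_eq_abs] at h1
    have h2 : η * |a (0, i)| ≤ η * ‖a‖ := by gcongr
    have h3 : 0 ≤ η * ‖a‖ := by positivity
    rw [Real.norm_eq_abs]
    linarith [h k i]
  · have hr0 : 0 < r.toReal := by linarith
    rw [PiLp.norm_eq_sum hr0, PiLp.norm_eq_sum hr0]
    simp only [Real.norm_eq_abs]
    have h1 : ∑ x : Fin 3 × S, |b x| ^ r.toReal ≤ (3 * η) ^ r.toReal * ∑ x, |a x| ^ r.toReal := by
      calc ∑ x : Fin 3 × S, |b x| ^ r.toReal
          = ∑ k : Fin 3, ∑ i : S, |b (k, i)| ^ r.toReal := Fintype.sum_prod_type _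
        _ ≤ ∑ _k : Fin 3, ∑ i : S, η ^ r.toReal * |a (0, i)| ^ r.toReal := by
            refine Finset.sum_le_sum fun k _ => Finset.sum_le_sum fun i _ => ?_
            rw [← Real.mul_rpow hη (abs_nonneg _)]
            exact Real.rpow_le_rpow (abs_nonneg _) (h k i) hr0.le
        _ = 3 * (η ^ r.toReal * ∑ i : S, |a (0, i)| ^ r.toReal) := by
            simp [Finset.mul_sum]
        _ ≤ 3 ^ r.toReal * (η ^ r.toReal * ∑ x, |a x| ^ r.toReal) := by
            -- The factor 3 counts the blocks; `r ≥ 1` allows it to be absorbed into an `r`-th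
            -- power.
            have h3 : (3 : ℝ) ≤ 3 ^ r.toReal := Real.self_le_rpow_of_one_le (by norm_num) hr
            gcongr
            rw [Fintype.sum_prod_type]
            exact Finset.single_le_sum (f := fun k : Fin 3 => ∑ i : S, |a (k, i)| ^ r.toReal)
              (fun k _ => by positivity) (Finset.mem_univ 0)
        _ = _ := by rw [Real.mul_rpow (by norm_num) hη]; ring
    calc _ ≤ ((3 * η) ^ r.toReal * ∑ x, |a x| ^ r.toReal) ^ (1 / r.toReal) := by
          apply Real.rpow_le_rpow (by positivity) h1 (by positivity)
      _ = _ := by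
          rw [Real.mul_rpow (by positivity) (by positivity), ← Real.rpow_mul (by positivity),
            mul_one_div_cancel hr0.ne', Real.rpow_one]

namespace HermiteData

variable {M : TriMesh} (D : HermiteData M)

/-- Substituting `c + T x` makes the rescaled deviation `x` from a reference `c` the unknown of a
least-squares problem with matrix ΩDUT. -/
theorem residual_add_colScaling {p : ℕ} {h : ℝ} (v : Fin M.numVerts) (c x : MonoIdx p → ℝ) :
    D.residual h v (c + (colScaling h p).mulVec x) =
      ‖WithLp.toLp 2 ((D.weightMatrix v * D.rescaledMatrix p h v).mulVec x -
        (D.weightMatrix v * D.rowScaling h v).mulVec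
          (D.fitRhs v - (D.fitMatrix p v).mulVec c))‖ := by
  unfold residual rescaledMatrix
  congr 2
  simp only [Matrix.mulVec_sub, Matrix.mulVec_add, ← Matrix.mulVec_mulVec]
  abel

/-- The coefficients of a weighted least-squares fitting are close to any coefficients for which
all the rows of the unweighted system have small residuals, independently of the number of
rows. -/
theorem abs_coeff_sub_le {p : ℕ} {h κ η : ℝ} (hh : 0 < h) (r : ℝ≥0∞) [Fact (1 ≤ r)]
    {v : Fin M.numVerts} {c c' : MonoIdx p → ℝ} (hc : D.IsFit h v c)
    (hκ : IsWellConditioned r κ (D.weightMatrix v * D.rescaledMatrix p h v)) (hη : 0 ≤ η)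
    (hrow : ∀ row, |![1, h, h] row.1 * (D.fitRhs v row - (D.fitMatrix p v).mulVec c' row)| ≤ η)
    (a : MonoIdx p) : |c a - c' a| * h ^ (a.1.1.val + a.1.2.val) ≤ 3 * κ * η := by
  set A := D.weightMatrix v * D.rescaledMatrix p h v with hA
  set b := (D.weightMatrix v * D.rowScaling h v).mulVec
    (D.fitRhs v - (D.fitMatrix p v).mulVec c') with hb
  set x : MonoIdx p → ℝ := fun a => h ^ (a.1.1.val + a.1.2.val) * (c a - c' a) with hx
  have hcx : c = c' + (colScaling h p).mulVec x := by
    funext a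
    have : h ^ (a.1.1.val + a.1.2.val) ≠ 0 := by positivity
    simp only [colScaling, Pi.add_apply, Matrix.mulVec_diagonal, hx]
    field_simp
    ring
  have hmin : x = (pseudoinverse A).mulVec b := by
    refine eq_pseudoinverse_mulVec_of_forall_norm_le hκ.1 fun x' => ?_
    have h1 := hc (c' + (colScaling h p).mulVec x')
    rw [hcx] at h1
    rwa [residual_add_colScaling, residual_add_colScaling] at h1
  -- The column of the constant monomial has the weights as its entries in the height rows. It
  -- serves as a yardstick for the weighted residual `b`, which makes ‖b‖ comparable to ‖A‖ without
  -- counting rows.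
  let e : MonoIdx p := ⟨(0, 0), by simp⟩
  have hcol : ∀ i, A.mulVec (Pi.single e 1) (0, i) = D.weight v i := by
    intro i
    simp [hA, weightMatrix, rescaledMatrix, rowScaling, fitMatrix, colScaling, e]
  have hbA : ‖WithLp.toLp r b‖ ≤ 3 * η * ‖WithLp.toLp r (A.mulVec (Pi.single e 1))‖ := by
    refine norm_toLp_le_of_forall_abs_le r hη fun k i => ?_
    rw [hcol]
    have h1 : b (k, i) = D.weight v i *
        (![1, h, h] k * (D.fitRhs v (k, i) - (D.fitMatrix p v).mulVec c' (k, i))) := by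
      simp only [hb, ← Matrix.mulVec_mulVec, weightMatrix, rowScaling, Matrix.mulVec_diagonal,
        Pi.sub_apply]
    rw [h1, abs_mul, mul_comm]
    gcongr
    exact hrow (k, i)
  have hAe : ‖WithLp.toLp r (A.mulVec (Pi.single e 1))‖ ≤ matrixLpNorm r A := by
    refine (norm_toLp_mulVec_le r A _).trans ?_
    have h1 : ‖WithLp.toLp r (Pi.single e 1 : MonoIdx p → ℝ)‖ = 1 :=
      (PiLp.norm_single r (fun _ : MonoIdx p => ℝ) e 1).trans norm_one
    rw [h1, mul_one]
  have hxn : ‖WithLp.toLp r x‖ ≤ 3 * κ * η := by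
    calc ‖WithLp.toLp r x‖ ≤ matrixLpNorm r (pseudoinverse A) * ‖WithLp.toLp r b‖ := by
          rw [hmin]; exact norm_toLp_mulVec_le r _ _
      _ ≤ matrixLpNorm r (pseudoinverse A) * (3 * η * matrixLpNorm r A) := by
          have := matrixLpNorm_nonneg r (pseudoinverse A)
          gcongr
          exact hbA.trans (by gcongr)
      _ = 3 * (matrixLpNorm r A * matrixLpNorm r (pseudoinverse A)) * η := by ring
      _ ≤ 3 * κ * η := by
          have := hκ.2
          gcongr
  have h2 := (PiLp.norm_apply_le (WithLp.toLp r x) a).trans hxn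
  simp only [hx, Real.norm_eq_abs, abs_mul] at h2
  rwa [abs_of_pos (by positivity : 0 < h ^ (a.1.1.val + a.1.2.val)), mul_comm] at h2

end HermiteData

/-! ### Quantitative estimates for polynomials -/

/-- The coefficients of a polynomial of degree `m` are bounded by `L`. -/
def CoeffBound (m : ℕ) (c : ℕ → ℕ → ℝ) (L : ℝ) : Prop := ∀ j k, j + k ≤ m → |c j k| ≤ L

theorem CoeffBound.left {m : ℕ} {c : ℕ → ℕ → ℝ} {L : ℝ} (h : CoeffBound (m + 1) c L) :
    CoeffBound m (fun j k => (j + 1) * c (j + 1) k) ((m + 1) * L) := by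
  intro j k hjk
  have h1 := h (j + 1) k (by omega)
  rw [abs_mul, abs_of_nonneg (by positivity)]
  have : (j : ℝ) ≤ m := by exact_mod_cast (by omega : j ≤ m)
  gcongr

theorem CoeffBound.right {m : ℕ} {c : ℕ → ℕ → ℝ} {L : ℝ} (h : CoeffBound (m + 1) c L) :
    CoeffBound m (fun j k => (k + 1) * c j (k + 1)) ((m + 1) * L) := by
  intro j k hjk
  have h1 := h j (k + 1) (by omega)
  rw [abs_mul, abs_of_nonneg (by positivity)]
  have : (k : ℝ) ≤ m := by exact_mod_cast (by omega : k ≤ m)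
  gcongr

theorem CoeffBound.nonneg {m : ℕ} {c : ℕ → ℕ → ℝ} {L : ℝ} (h : CoeffBound m c L) : 0 ≤ L :=
  (abs_nonneg _).trans (h 0 0 (by simp))

theorem exists_abs_polyEval_le (m : ℕ) : ∃ N : ℝ, 0 ≤ N ∧ ∀ (c : ℕ → ℕ → ℝ) (L : ℝ),
    CoeffBound m c L → ∀ w : ℝ × ℝ, ‖w‖ ≤ 1 → |polyEval m c w.1 w.2| ≤ N * L := by
  -- The constant is the number of monomials, each of which is at most 1 in the unit ball.
  refine ⟨∑ j ∈ Finset.range (m + 1), ∑ _k ∈ Finset.range (m + 1 - j), 1, by positivity, ?_⟩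
  intro c L hc w hw
  have hu : |w.1| ≤ 1 := (norm_fst_le w).trans hw
  have hv : |w.2| ≤ 1 := (norm_snd_le w).trans hw
  unfold polyEval
  rw [Finset.sum_mul]
  refine (Finset.abs_sum_le_sum_abs _ _).trans (Finset.sum_le_sum fun j hj => ?_)
  rw [Finset.sum_mul]
  refine (Finset.abs_sum_le_sum_abs _ _).trans (Finset.sum_le_sum fun k hk => ?_)
  have := Finset.mem_range.1 hj
  have := Finset.mem_range.1 hk
  have h1 := hc j k (by omega)
  rw [abs_mul, abs_mul, abs_pow, abs_pow, one_mul]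
  have h2 : |w.1| ^ j ≤ 1 := pow_le_one₀ (abs_nonneg _) hu
  have h3 : |w.2| ^ k ≤ 1 := pow_le_one₀ (abs_nonneg _) hv
  calc |c j k| * |w.1| ^ j * |w.2| ^ k ≤ L * 1 * 1 := by
        have := hc.nonneg
        gcongr
    _ = L := by ring

theorem norm_smul_fst_add_smul_snd_le (A B : ℝ) :
    ‖A • ContinuousLinearMap.fst ℝ ℝ ℝ + B • ContinuousLinearMap.snd ℝ ℝ ℝ‖ ≤ |A| + |B| := by
  refine (norm_add_le _ _).trans (add_le_add ?_ ?_)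
  · rw [norm_smul, Real.norm_eq_abs]
    exact mul_le_of_le_one_right (abs_nonneg _) (ContinuousLinearMap.norm_fst_le ..)
  · rw [norm_smul, Real.norm_eq_abs]
    exact mul_le_of_le_one_right (abs_nonneg _) (ContinuousLinearMap.norm_snd_le ..)

theorem exists_abs_polyEval_sub_le (m : ℕ) : ∃ N : ℝ, 0 ≤ N ∧ ∀ (c : ℕ → ℕ → ℝ) (L : ℝ),
    CoeffBound m c L → ∀ w w' : ℝ × ℝ, ‖w‖ ≤ 1 → ‖w'‖ ≤ 1 →
      |polyEval m c w'.1 w'.2 - polyEval m c w.1 w.2| ≤ N * L * ‖w' - w‖ := by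
  cases m with
  | zero => exact ⟨0, le_rfl, fun c L _ w w' _ _ => by simp [polyEval]⟩
  | succ m =>
    obtain ⟨N, hN, hb⟩ := exists_abs_polyEval_le m
    refine ⟨2 * (N * (m + 1)), by positivity, fun c L hc w w' hw hw' => ?_⟩
    refine (convex_closedBall (0 : ℝ × ℝ) 1).norm_image_sub_le_of_norm_hasFDerivWithin_le
      (f := fun w : ℝ × ℝ => polyEval (m + 1) c w.1 w.2)
      (fun z _ => (hasFDerivAt_polyEval m c z).hasFDerivWithinAt) (fun z hz => ?_)
      (by simpa using hw) (by simpa using hw')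
    have hz' : ‖z‖ ≤ 1 := by simpa using hz
    refine (norm_smul_fst_add_smul_snd_le _ _).trans ?_
    have h1 := hb _ _ hc.left z hz'
    have h2 := hb _ _ hc.right z hz'
    linarith

theorem exists_abs_polyEval_taylor_le (m : ℕ) : ∃ N : ℝ, 0 ≤ N ∧ ∀ (c : ℕ → ℕ → ℝ) (L : ℝ),
    CoeffBound (m + 1) c L → ∀ w : ℝ × ℝ, ‖w‖ ≤ 1 → ∃ g : ℝ × ℝ →L[ℝ] ℝ, ∀ w' : ℝ × ℝ, ‖w'‖ ≤ 1 →
      |polyEval (m + 1) c w'.1 w'.2 - polyEval (m + 1) c w.1 w.2 - g (w' - w)| ≤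
        N * L * ‖w' - w‖ ^ 2 := by
  obtain ⟨N, hN, hb⟩ := exists_abs_polyEval_sub_le m
  refine ⟨2 * (N * (m + 1)), by positivity, fun c L hc w hw =>
    ⟨polyEval m (fun j k => (j + 1) * c (j + 1) k) w.1 w.2 • ContinuousLinearMap.fst ℝ ℝ ℝ +
      polyEval m (fun j k => (k + 1) * c j (k + 1)) w.1 w.2 • ContinuousLinearMap.snd ℝ ℝ ℝ,
      fun w' hw' => ?_⟩⟩
  -- The first ball keeps the coefficient estimates valid; in the second one the gradient differs
  -- from that at `w` by a multiple of ‖w' - w‖.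
  · have key := ((convex_closedBall (0 : ℝ × ℝ) 1).inter
      (convex_closedBall w ‖w' - w‖)).norm_image_sub_le_of_norm_hasFDerivWithin_le'
      (f := fun w : ℝ × ℝ => polyEval (m + 1) c w.1 w.2)
      (C := 2 * (N * (m + 1)) * L * ‖w' - w‖)
      (φ := polyEval m (fun j k => (j + 1) * c (j + 1) k) w.1 w.2 •
        ContinuousLinearMap.fst ℝ ℝ ℝ + polyEval m (fun j k => (k + 1) * c j (k + 1)) w.1 w.2 •
        ContinuousLinearMap.snd ℝ ℝ ℝ)
      (fun z _ => (hasFDerivAt_polyEval m c z).hasFDerivWithinAt) (fun z hz => ?_)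
      (x := w) (y := w') (by simpa using hw) (by simpa [dist_eq_norm] using hw')
    · rw [pow_two, ← mul_assoc]
      exact key
    · have hz1 : ‖z‖ ≤ 1 := by simpa using hz.1
      have hz2 : ‖z - w‖ ≤ ‖w' - w‖ := by simpa [dist_eq_norm] using hz.2
      rw [add_sub_add_comm, ← sub_smul, ← sub_smul]
      refine (norm_smul_fst_add_smul_snd_le _ _).trans ?_
      have hL := hc.nonneg
      have h1 := hb _ _ hc.left w z hw hz1
      have h2 := hb _ _ hc.right w z hw hz1
      have h3 : N * ((m + 1) * L) * ‖z - w‖ ≤ N * ((m + 1) * L) * ‖w' - w‖ := by gcongr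
      linarith

/-! ### The defect of a point with respect to a polynomial graph -/

/-- The height of the point `z` above the graph of the polynomial with coefficients `c`. -/
def graphDefect (m : ℕ) (x : E3) (b : Fin 3 → E3) (c : ℕ → ℕ → ℝ) (z : E3) : ℝ :=
  frameCoord x b 2 z - polyEval m c (frameCoord x b 0 z) (frameCoord x b 1 z)

/-- The projection of `z` to the plane of the first two axes of the frame. -/
def planeCoord (x : E3) (b : Fin 3 → E3) (z : E3) : ℝ × ℝ := (frameCoord x b 0 z, frameCoord x b 1 z)

theorem frameCoord_sub (x : E3) (b : Fin 3 → E3) (i : Fin 3) (z z' : E3) :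
    frameCoord x b i z - frameCoord x b i z' = inner ℝ (b i) (z - z') := by
  rw [← inner_sub_right, sub_sub_sub_cancel_right]

theorem norm_planeCoord_le (x : E3) (b : OrthonormalBasis (Fin 3) ℝ E3) (z : E3) :
    ‖planeCoord x b z‖ ≤ ‖z - x‖ :=
  max_le (abs_inner_le_norm_of_basis b 0 _) (abs_inner_le_norm_of_basis b 1 _)

theorem planeCoord_sub (x : E3) (b : Fin 3 → E3) (z z' : E3) :
    planeCoord x b z - planeCoord x b z' = (inner ℝ (b 0) (z - z'), inner ℝ (b 1) (z - z')) :=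
  Prod.ext (frameCoord_sub x b 0 z z') (frameCoord_sub x b 1 z z')

theorem norm_planeCoord_sub_le (x : E3) (b : OrthonormalBasis (Fin 3) ℝ E3) (z z' : E3) :
    ‖planeCoord x b z - planeCoord x b z'‖ ≤ ‖z - z'‖ := by
  rw [planeCoord_sub]
  exact max_le (abs_inner_le_norm_of_basis b 0 _) (abs_inner_le_norm_of_basis b 1 _)

theorem exists_abs_graphDefect_sub_le (n : ℕ) : ∃ N : ℝ, 1 ≤ N ∧ ∀ (x : E3)
    (b : OrthonormalBasis (Fin 3) ℝ E3) (c : ℕ → ℕ → ℝ) (L : ℝ), CoeffBound (n + 1) c L → 1 ≤ L →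
    ∀ z z' : E3, ‖z - x‖ ≤ 1 → ‖z' - x‖ ≤ 1 →
      |graphDefect (n + 1) x b c z - graphDefect (n + 1) x b c z'| ≤ N * L * ‖z - z'‖ := by
  obtain ⟨N, hN, h⟩ := exists_abs_polyEval_sub_le (n + 1)
  refine ⟨1 + N, by linarith, fun x b c L hc hL z z' hz hz' => ?_⟩
  have h1 := h c L hc (planeCoord x b z') (planeCoord x b z)
    ((norm_planeCoord_le x b z').trans hz') ((norm_planeCoord_le x b z).trans hz)
  have h2 : |frameCoord x b 2 z - frameCoord x b 2 z'| ≤ ‖z - z'‖ := by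
    rw [frameCoord_sub]; exact abs_inner_le_norm_of_basis b 2 _
  have h3 := norm_planeCoord_sub_le x b z z'
  have h4 : N * L * ‖planeCoord x b z - planeCoord x b z'‖ ≤ N * L * ‖z - z'‖ := by gcongr
  have h5 : 1 * ‖z - z'‖ ≤ L * ‖z - z'‖ := by gcongr
  unfold graphDefect
  have h6 := abs_sub (frameCoord x b 2 z - frameCoord x b 2 z')
    (polyEval (n + 1) c (frameCoord x b 0 z) (frameCoord x b 1 z) -
      polyEval (n + 1) c (frameCoord x b 0 z') (frameCoord x b 1 z'))
  have h7 : ∀ p q r s : ℝ, p - q - (r - s) = p - r - (q - s) := fun p q r s => by ring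
  rw [h7]
  refine h6.trans ?_
  have h1' : |polyEval (n + 1) c (frameCoord x b 0 z) (frameCoord x b 1 z) -
      polyEval (n + 1) c (frameCoord x b 0 z') (frameCoord x b 1 z')| ≤ _ := h1
  linarith

theorem norm_sum_smul_sub_le {ι E : Type*} [NormedAddCommGroup E] [NormedSpace ℝ E]
    {T : Finset ι} {ξ : ι → ℝ} (hξ : ∀ i ∈ T, 0 ≤ ξ i) (hξ1 : ∑ i ∈ T, ξ i = 1) {z : ι → E} {a : E}
    {d : ℝ} (hd : ∀ i ∈ T, ‖z i - a‖ ≤ d) : ‖∑ i ∈ T, ξ i • z i - a‖ ≤ d := by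
  have h1 : ∑ i ∈ T, ξ i • z i - a = ∑ i ∈ T, ξ i • (z i - a) := by
    simp only [smul_sub, Finset.sum_sub_distrib, ← Finset.sum_smul, hξ1, one_smul]
  rw [h1]
  refine (norm_sum_le _ _).trans ?_
  calc ∑ i ∈ T, ‖ξ i • (z i - a)‖ ≤ ∑ i ∈ T, ξ i * d := by
        refine Finset.sum_le_sum fun i hi => ?_
        rw [norm_smul, Real.norm_eq_abs, abs_of_nonneg (hξ i hi)]
        have := hξ i hi
        have := hd i hi
        gcongr
    _ = d := by rw [← Finset.sum_mul, hξ1, one_mul]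

/-- The defect is affine up to an error which is quadratic in the diameter. -/
theorem exists_abs_graphDefect_sum_le (n : ℕ) : ∃ N : ℝ, 0 ≤ N ∧ ∀ (x : E3)
    (b : OrthonormalBasis (Fin 3) ℝ E3) (c : ℕ → ℕ → ℝ) (L : ℝ), CoeffBound (n + 1) c L →
    ∀ {ι : Type} (T : Finset ι) (ξ : ι → ℝ) (z : ι → E3) (d : ℝ), (∀ i ∈ T, 0 ≤ ξ i) →
      ∑ i ∈ T, ξ i = 1 → (∀ i ∈ T, ‖z i - x‖ ≤ 1) → (∀ i ∈ T, ∀ j ∈ T, ‖z i - z j‖ ≤ d) →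
      |graphDefect (n + 1) x b c (∑ i ∈ T, ξ i • z i) -
        ∑ i ∈ T, ξ i * graphDefect (n + 1) x b c (z i)| ≤ N * L * d ^ 2 := by
  obtain ⟨N, hN, h⟩ := exists_abs_polyEval_taylor_le n
  refine ⟨N, hN, fun x b c L hc ι T ξ z d hξ hξ1 hz hd => ?_⟩
  set q := ∑ i ∈ T, ξ i • z i with hq
  have hqx : ‖q - x‖ ≤ 1 := norm_sum_smul_sub_le hξ hξ1 hz
  have hzq : ∀ i ∈ T, ‖z i - q‖ ≤ d := fun i hi => by
    rw [norm_sub_rev]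
    exact norm_sum_smul_sub_le hξ hξ1 fun j hj => hd j hj i hi
  -- The polynomial is linearized at the barycentre `q`, where the weighted sum of the linear terms
  -- vanishes and only quadratic remainders survive.
  obtain ⟨g, hg⟩ := h c L hc (planeCoord x b q) ((norm_planeCoord_le x b q).trans hqx)
  have hsum : ∀ i, ∑ j ∈ T, ξ j * inner ℝ (b i) (z j - q) = 0 := by
    intro i
    have h0 : ∑ j ∈ T, ξ j • (z j - q) = 0 := by
      simp only [smul_sub, Finset.sum_sub_distrib, ← Finset.sum_smul, hξ1, one_smul]
      rw [hq, sub_self]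
    have := congrArg (inner ℝ (b i)) h0
    simpa [inner_sum, inner_smul_right] using this
  have hgsum : ∑ j ∈ T, ξ j * g (planeCoord x b (z j) - planeCoord x b q) = 0 := by
    have h0 : ∑ j ∈ T, ξ j • (planeCoord x b (z j) - planeCoord x b q) = 0 := by
      simp only [planeCoord_sub]
      refine Prod.ext ?_ ?_
      · simpa [Prod.fst_sum] using hsum 0
      · simpa [Prod.snd_sum] using hsum 1
    have := congrArg g h0
    simpa [map_sum] using this
  have key : graphDefect (n + 1) x b c q - ∑ i ∈ T, ξ i * graphDefect (n + 1) x b c (z i) =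
      ∑ i ∈ T, ξ i * (polyEval (n + 1) c (planeCoord x b (z i)).1 (planeCoord x b (z i)).2 -
        polyEval (n + 1) c (planeCoord x b q).1 (planeCoord x b q).2 -
        g (planeCoord x b (z i) - planeCoord x b q)) := by
    have e1 : ∑ i ∈ T, ξ i * (frameCoord x b 2 (z i) - frameCoord x b 2 q) = 0 := by
      simp only [frameCoord_sub]; exact hsum 2
    simp only [mul_sub, Finset.sum_sub_distrib, ← Finset.sum_mul, hξ1, one_mul] at e1
    simp only [graphDefect, planeCoord, map_sub, mul_sub, Finset.sum_sub_distrib,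
      ← Finset.sum_mul, hξ1, one_mul] at hgsum ⊢
    linarith
  rw [key]
  refine (Finset.abs_sum_le_sum_abs _ _).trans ?_
  calc _ ≤ ∑ i ∈ T, ξ i * (N * L * d ^ 2) := by
        refine Finset.sum_le_sum fun i hi => ?_
        rw [abs_mul, abs_of_nonneg (hξ i hi)]
        have h0 := hξ i hi
        have h1 := hg (planeCoord x b (z i)) ((norm_planeCoord_le x b _).trans (hz i hi))
        have h2 := (norm_planeCoord_sub_le x b (z i) q).trans (hzq i hi)
        have hL := hc.nonneg
        gcongr
        refine h1.trans ?_
        gcongr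
    _ = N * L * d ^ 2 := by rw [← Finset.sum_mul, hξ1, one_mul]

theorem IsGraphModel.coeffBound {Γ : Set E3} {n : ℕ} {δ L : ℝ} {x : E3} {b : Fin 3 → E3}
    {c : ℕ → ℕ → ℝ} (h : IsGraphModel Γ n δ L x b c) : CoeffBound (n + 1) c L := h.coeff_le

/-- Moving `q` along the third axis onto Γ changes it by its height above the true graph, which is
its defect up to the model error. -/
theorem IsGraphModel.exists_norm_sub_le {Γ : Set E3} {n : ℕ} {δ L : ℝ} {x : E3}
    {b : OrthonormalBasis (Fin 3) ℝ E3} {c : ℕ → ℕ → ℝ} (h : IsGraphModel Γ n δ L x b c)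
    {q : E3} (hq : ‖q - x‖ ≤ δ) :
    ∃ z ∈ Γ, ‖q - z‖ ≤ |graphDefect (n + 1) x b c q| + L * ‖q - x‖ ^ (n + 2) := by
  obtain ⟨w, hw, hle⟩ := h.exists_mem (frameCoord x b 0 q) (frameCoord x b 1 q)
    ((abs_inner_le_norm_of_basis b 0 _).trans hq) ((abs_inner_le_norm_of_basis b 1 _).trans hq)
  refine ⟨_, hw, ?_⟩
  have hs := sum_inner_smul_add b (q - x)
  have e : q - (x + frameCoord x b 0 q • b 0 + frameCoord x b 1 q • b 1 + w • b 2) =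
      (frameCoord x b 2 q - w) • b 2 := by
    have : q = x + (q - x) := by abel
    nth_rw 1 [this]
    rw [← hs]
    module
  rw [e, norm_smul, b.norm_eq_one, mul_one, Real.norm_eq_abs]
  have h2 : max |frameCoord x b 0 q| |frameCoord x b 1 q| ≤ ‖q - x‖ :=
    max_le (abs_inner_le_norm_of_basis b 0 _) (abs_inner_le_norm_of_basis b 1 _)
  have hL := h.coeffBound.nonneg
  have h3 : L * max |frameCoord x b 0 q| |frameCoord x b 1 q| ^ (n + 2) ≤
      L * ‖q - x‖ ^ (n + 2) := by gcongr
  have h4 := abs_sub_abs_le_abs_sub w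
    (polyEval (n + 1) c (frameCoord x b 0 q) (frameCoord x b 1 q))
  have e2 : frameCoord x b 2 q - w = graphDefect (n + 1) x b c q -
      (w - polyEval (n + 1) c (frameCoord x b 0 q) (frameCoord x b 1 q)) := by
    unfold graphDefect; ring
  rw [e2]
  refine (abs_sub _ _).trans ?_
  linarith

/-! ### Errors of the rows of the fitting system -/

theorem exists_forall_mul_le {A ε : ℝ} (hA : 0 ≤ A) (hε : 0 < ε) :
    ∃ h₁ : ℝ, 0 < h₁ ∧ h₁ ≤ 1 ∧ ∀ h, h ≤ h₁ → A * h ≤ ε := by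
  refine ⟨min 1 (ε / (A + 1)), by positivity, min_le_left _ _, fun h hh => ?_⟩
  have h1 : h ≤ ε / (A + 1) := hh.trans (min_le_right _ _)
  have h2 : A * h ≤ A * (ε / (A + 1)) := by gcongr
  refine h2.trans ?_
  rw [← mul_div_assoc, div_le_iff₀ (by positivity)]
  nlinarith

theorem pow_succ_le_self {h : ℝ} (h0 : 0 ≤ h) (h1 : h ≤ 1) (n : ℕ) : h ^ (n + 1) ≤ h :=
  pow_le_of_le_one h0 h1 (by omega)

/-- The error equals -(α + Pγ)/γ. The numerator differs from α' + P'γ' by small terms, and γ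
inherits a lower bound from γ'. The quotient does not see the sign of the normal. -/
theorem abs_slope_sub_le {α α' γ γ' P P' E B L : ℝ} (h1 : |α' + P' * γ'| ≤ E)
    (h2 : |α - α'| ≤ E) (h3 : |γ - γ'| ≤ E) (h4 : |P - P'| ≤ E) (h5 : |P| ≤ B) (h6 : |γ'| ≤ 1)
    (h7 : 1 ≤ L * |γ'|) (h8 : L * E ≤ 1 / 2) (hL : 0 ≤ L) :
    |-(α / γ) - P| ≤ 2 * L * (3 + B) * E := by
  have hE : 0 ≤ E := (abs_nonneg _).trans h1
  have hB : 0 ≤ B := (abs_nonneg _).trans h5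
  have hγ : 1 / 2 ≤ L * |γ| := by
    have : |γ'| - |γ| ≤ E := (abs_sub_abs_le_abs_sub _ _).trans (by rwa [abs_sub_comm])
    nlinarith
  have hγ0 : γ ≠ 0 := by
    rintro rfl
    rw [abs_zero, mul_zero] at hγ
    linarith
  have e : -(α / γ) - P = -((α + P * γ) / γ) := by field_simp; ring
  have hnum : |α + P * γ| ≤ (3 + B) * E := by
    have e2 : α + P * γ = (α' + P' * γ') + (α - α') + P * (γ - γ') + (P - P') * γ' := by ring
    have h9 : |P * (γ - γ')| ≤ B * E := by rw [abs_mul]; gcongr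
    have h10 : |(P - P') * γ'| ≤ E := by
      rw [abs_mul]
      exact (mul_le_of_le_one_right (abs_nonneg _) h6).trans h4
    rw [e2]
    refine (abs_add_le _ _).trans ?_
    have := abs_add_le (α' + P' * γ' + (α - α')) (P * (γ - γ'))
    have := abs_add_le (α' + P' * γ') (α - α')
    linarith
  rw [e, abs_neg, abs_div, div_le_iff₀ (abs_pos.2 hγ0)]
  have : (3 + B) * E * (1 / 2) ≤ (3 + B) * E * (L * |γ|) := by gcongr
  linarith

/-- Here `z` is a stencil vertex with given normal `m`, and `y`, `ν` are the exact point and normal.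
The defect is carried from `y` to `z` by its Lipschitz bound. The slopes may be one order worse,
because their rows are multiplied by `h`. -/
theorem exists_row_bounds (n : ℕ) {δ L C₀ R : ℝ} (hδ : 0 < δ) (hδ1 : δ ≤ 1) (hL : 1 ≤ L)
    (hC₀ : 0 ≤ C₀) (hR : 0 ≤ R) : ∃ C h₁ : ℝ, 0 ≤ C ∧ 0 < h₁ ∧
    ∀ (Γ : Set E3) (x : E3) (b : OrthonormalBasis (Fin 3) ℝ E3) (c : ℕ → ℕ → ℝ),
      IsGraphModel Γ n δ L x b c → ∀ h, 0 < h → h ≤ h₁ → ∀ z y m ν : E3, y ∈ Γ →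
      ‖z - y‖ ≤ C₀ * h ^ (n + 2) → ‖z - x‖ ≤ R * h → IsUnitNormal Γ y ν →
      ‖m - ν‖ ≤ C₀ * h ^ (n + 1) →
      |graphDefect (n + 1) x b c z| ≤ C * h ^ (n + 2) ∧
      |-(inner ℝ (b 0) m / inner ℝ (b 2) m) - polyEval n (fun j k => (j + 1) * c (j + 1) k)
        (frameCoord x b 0 z) (frameCoord x b 1 z)| ≤ C * h ^ (n + 1) ∧
      |-(inner ℝ (b 1) m / inner ℝ (b 2) m) - polyEval n (fun j k => (k + 1) * c j (k + 1))
        (frameCoord x b 0 z) (frameCoord x b 1 z)| ≤ C * h ^ (n + 1) := by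
  obtain ⟨N₀, hN₀, hb₀⟩ := exists_abs_polyEval_le n
  obtain ⟨N₁, hN₁, hb₁⟩ := exists_abs_polyEval_sub_le n
  obtain ⟨N₂, hN₂, hb₂⟩ := exists_abs_graphDefect_sub_le n
  set L' := (n + 1) * L with hL'
  have hL'0 : 0 ≤ L' := by positivity
  -- Three slope errors: the model at `y`, the given normal, and the move of the polynomial from `y`
  -- to `z`.
  set E := L * (R + C₀) ^ (n + 1) + C₀ + N₁ * L' * C₀ with hE
  have hE0 : 0 ≤ E := by positivity
  obtain ⟨h₁, hh₁, hh₁1, hsmall₁⟩ := exists_forall_mul_le (by positivity : 0 ≤ R + C₀) hδ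
  obtain ⟨h₂, hh₂, hh₂1, hsmall₂⟩ := exists_forall_mul_le (by positivity : 0 ≤ L * E)
    (by norm_num : (0 : ℝ) < 1 / 2)
  set C₁ := L * (R + C₀) ^ (n + 2) + N₂ * L * C₀ with hC₁
  set C₂ := 2 * L * (3 + N₀ * L') * E with hC₂
  have hC₁0 : 0 ≤ C₁ := by positivity
  have hC₂0 : 0 ≤ C₂ := by positivity
  refine ⟨C₁ + C₂, min h₁ h₂, by positivity, lt_min hh₁ hh₂, ?_⟩
  intro Γ x b c hm h h0 hh z y m ν hy hzy hzx hν hmν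
  have hh1 : h ≤ 1 := (hh.trans (min_le_left _ _)).trans hh₁1
  have hzyh : ‖z - y‖ ≤ C₀ * h :=
    hzy.trans (by have := pow_succ_le_self h0.le hh1 (n + 1); gcongr)
  have hyx : ‖y - x‖ ≤ (R + C₀) * h := by
    have := norm_sub_le (z - x) (z - y)
    rw [sub_sub_sub_cancel_left] at this
    linarith
  have hyδ : ‖y - x‖ ≤ δ := hyx.trans (hsmall₁ h (hh.trans (min_le_left _ _)))
  have hzδ : ‖z - x‖ ≤ δ := hzx.trans (le_trans (by gcongr; linarith)
    (hsmall₁ h (hh.trans (min_le_left _ _))))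
  have hpow : h ^ (n + 2) ≤ h ^ (n + 1) := pow_le_pow_of_le_one h0.le hh1 (by omega)
  have hpow0 : 0 ≤ h ^ (n + 1) := by positivity
  have hpow1 : h ^ (n + 1) ≤ h := pow_succ_le_self h0.le hh1 n
  have hLE : L * (E * h ^ (n + 1)) ≤ 1 / 2 := by
    rw [← mul_assoc]
    exact le_trans (by gcongr) (hsmall₂ h (hh.trans (min_le_right _ _)))
  have hslope : ∀ (i : Fin 3) (c' : ℕ → ℕ → ℝ), CoeffBound n c' L' →
      |inner ℝ (b i) ν + polyEval n c' (frameCoord x b 0 y) (frameCoord x b 1 y) *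
        inner ℝ (b 2) ν| ≤ L * ‖y - x‖ ^ (n + 1) →
      |-(inner ℝ (b i) m / inner ℝ (b 2) m) -
        polyEval n c' (frameCoord x b 0 z) (frameCoord x b 1 z)| ≤
        2 * L * (3 + N₀ * L') * (E * h ^ (n + 1)) := by
    intro i c' hc' hnormal
    have hin : ∀ i, |inner ℝ (b i) m - inner ℝ (b i) ν| ≤ E * h ^ (n + 1) := by
      intro i
      rw [← inner_sub_right]
      refine (abs_inner_le_norm_of_basis b i _).trans (hmν.trans ?_)
      gcongr
      rw [hE]
      have : 0 ≤ L * (R + C₀) ^ (n + 1) := by positivity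
      have : 0 ≤ N₁ * L' * C₀ := by positivity
      linarith
    refine abs_slope_sub_le (hnormal.trans ?_) (hin i) (hin 2) ?_
      (hb₀ c' L' hc' (planeCoord x b z) ((norm_planeCoord_le x b z).trans (hzδ.trans hδ1)))
      (hν.1 ▸ abs_inner_le_norm_of_basis b 2 ν) (hm.normal_ne y hy hyδ ν hν) hLE (by linarith)
    · calc L * ‖y - x‖ ^ (n + 1) ≤ L * ((R + C₀) * h) ^ (n + 1) := by gcongr
        _ = L * (R + C₀) ^ (n + 1) * h ^ (n + 1) := by rw [mul_pow]; ring
        _ ≤ E * h ^ (n + 1) := by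
          gcongr
          rw [hE]
          have : 0 ≤ N₁ * L' * C₀ := by positivity
          linarith
    · refine (hb₁ c' L' hc' (planeCoord x b y) (planeCoord x b z)
        ((norm_planeCoord_le x b y).trans (hyδ.trans hδ1))
        ((norm_planeCoord_le x b z).trans (hzδ.trans hδ1))).trans ?_
      calc N₁ * L' * ‖planeCoord x b z - planeCoord x b y‖ ≤ N₁ * L' * (C₀ * h ^ (n + 1)) := by
            have := (norm_planeCoord_sub_le x b z y).trans hzy
            gcongr
            exact this.trans (by gcongr)
        _ = N₁ * L' * C₀ * h ^ (n + 1) := by ring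
        _ ≤ E * h ^ (n + 1) := by
          gcongr
          rw [hE]
          have : 0 ≤ L * (R + C₀) ^ (n + 1) := by positivity
          linarith
  have hfin : 2 * L * (3 + N₀ * L') * (E * h ^ (n + 1)) ≤ (C₁ + C₂) * h ^ (n + 1) := by
    rw [← mul_assoc]; gcongr; linarith
  refine ⟨?_, (hslope 0 _ hm.coeffBound.left (hm.normal_left y hy hyδ ν hν)).trans hfin,
    (hslope 1 _ hm.coeffBound.right (hm.normal_right y hy hyδ ν hν)).trans hfin⟩
  have h1 := hb₂ x b c L hm.coeffBound hL z y (hzδ.trans hδ1) (hyδ.trans hδ1)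
  have h2 : |graphDefect (n + 1) x b c y| ≤ L * ‖y - x‖ ^ (n + 2) := hm.height y hy hyδ
  have h3 : L * ‖y - x‖ ^ (n + 2) ≤ L * (R + C₀) ^ (n + 2) * h ^ (n + 2) := by
    rw [mul_assoc, ← mul_pow]; gcongr
  have h4 : N₂ * L * ‖z - y‖ ≤ N₂ * L * C₀ * h ^ (n + 2) := by
    rw [mul_assoc _ C₀]; gcongr
  have h5 := abs_sub_abs_le_abs_sub (graphDefect (n + 1) x b c z) (graphDefect (n + 1) x b c y)
  have h6 : 0 ≤ C₂ * h ^ (n + 2) := by positivity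
  have h7 : (C₁ + C₂) * h ^ (n + 2) = L * (R + C₀) ^ (n + 2) * h ^ (n + 2) +
      N₂ * L * C₀ * h ^ (n + 2) + C₂ * h ^ (n + 2) := by rw [hC₁]; ring
  linarith

/-! ### Accuracy of the local fittings -/

theorem TriMesh.dist_le_of_mem_ring {M : TriMesh} {ε : ℝ}
    (hM : ∀ T ∈ M.faces, ∀ v ∈ T, ∀ w ∈ T, dist (M.pos v) (M.pos w) ≤ ε) {k : ℕ}
    {v i : Fin M.numVerts} (hi : i ∈ M.ring k v) : dist (M.pos i) (M.pos v) ≤ k * ε := by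
  induction k generalizing i with
  | zero =>
    have : i = v := by simpa [TriMesh.ring] using hi
    simp [this]
  | succ k ih =>
    simp only [TriMesh.ring, Finset.mem_biUnion, TriMesh.oneRing, Finset.mem_filter, id] at hi
    obtain ⟨w, hw, T, ⟨hT, hwT⟩, hiT⟩ := hi
    have h1 := dist_triangle (M.pos i) (M.pos w) (M.pos v)
    have h2 := hM T hT i hiT w hwT
    have h3 := ih hw
    push_cast
    linarith

namespace HermiteData

variable {M : TriMesh} (D : HermiteData M)

theorem coord_eq (v : Fin M.numVerts) (x : E3) (i : Fin 3) :
    D.coord v x i = frameCoord (M.pos v) (D.frame v) i x :=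
  (D.frame v).repr_apply_apply _ i

theorem fitMatrix_mulVec_zero (n : ℕ) (v : Fin M.numVerts) (c : ℕ → ℕ → ℝ)
    (i : {i // i ∈ D.stencil v}) :
    (D.fitMatrix (n + 1) v).mulVec (fun a => c a.1.1.val a.1.2.val) (0, i) =
      polyEval (n + 1) c (D.coord v (M.pos i) 0) (D.coord v (M.pos i) 1) := by
  rw [polyEval, ← sum_monoIdx (n + 1) fun j k =>
    c j k * D.coord v (M.pos i) 0 ^ j * D.coord v (M.pos i) 1 ^ k]
  refine Finset.sum_congr rfl fun a _ => ?_
  simp only [fitMatrix, Matrix.of_apply, Matrix.cons_val_zero]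
  ring

theorem fitMatrix_mulVec_one (n : ℕ) (v : Fin M.numVerts) (c : ℕ → ℕ → ℝ)
    (i : {i // i ∈ D.stencil v}) :
    (D.fitMatrix (n + 1) v).mulVec (fun a => c a.1.1.val a.1.2.val) (1, i) =
      polyEval n (fun j k => (j + 1) * c (j + 1) k) (D.coord v (M.pos i) 0)
        (D.coord v (M.pos i) 1) := by
  rw [← sum_mul_deriv_pow_left, ← sum_monoIdx (n + 1) fun j k =>
    c j k * j * D.coord v (M.pos i) 0 ^ (j - 1) * D.coord v (M.pos i) 1 ^ k]
  refine Finset.sum_congr rfl fun a _ => ?_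
  simp only [fitMatrix, Matrix.of_apply, Matrix.cons_val_one, Matrix.cons_val_zero]
  ring

theorem fitMatrix_mulVec_two (n : ℕ) (v : Fin M.numVerts) (c : ℕ → ℕ → ℝ)
    (i : {i // i ∈ D.stencil v}) :
    (D.fitMatrix (n + 1) v).mulVec (fun a => c a.1.1.val a.1.2.val) (2, i) =
      polyEval n (fun j k => (k + 1) * c j (k + 1)) (D.coord v (M.pos i) 0)
        (D.coord v (M.pos i) 1) := by
  rw [← sum_mul_deriv_pow_right, ← sum_monoIdx (n + 1) fun j k =>
    c j k * k * D.coord v (M.pos i) 0 ^ j * D.coord v (M.pos i) 1 ^ (k - 1)]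
  refine Finset.sum_congr rfl fun a _ => ?_
  simp only [fitMatrix, Matrix.of_apply, Matrix.cons_val]
  ring

/-- All the local points of `x` lie on lines through `x` itself along the third axes; this form is
what the averaging argument uses. -/
theorem localPoint_eq {p : ℕ} (v : Fin M.numVerts) (c : MonoIdx p → ℝ) (x : E3) :
    D.localPoint v c x = x + (evalPoly c (frameCoord (M.pos v) (D.frame v) 0 x)
      (frameCoord (M.pos v) (D.frame v) 1 x) - frameCoord (M.pos v) (D.frame v) 2 x) •
        D.frame v 2 := by
  have h1 := sum_inner_smul_add (D.frame v) (x - M.pos v)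
  unfold localPoint
  rw [← (D.frame v).sum_repr_symm]
  simp only [Fin.sum_univ_three, coord_eq]
  simp only [Matrix.cons_val_zero, Matrix.cons_val_one, Matrix.cons_val]
  refine sub_eq_zero.1 (Eq.trans ?_ (sub_eq_zero.2 h1))
  module

end HermiteData

theorem frameCoord_add_smul (x : E3) (b : Fin 3 → E3) (i : Fin 3) (z m : E3) (t : ℝ) :
    frameCoord x b i (z + t • m) = frameCoord x b i z + t * inner ℝ (b i) m := by
  rw [frameCoord, add_sub_right_comm, inner_add_right, inner_smul_right]

theorem graphDefect_add_smul_third {m : ℕ} (x : E3) (b : OrthonormalBasis (Fin 3) ℝ E3)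
    (c : ℕ → ℕ → ℝ) (z : E3) (t : ℝ) :
    graphDefect m x b c (z + t • b 2) = graphDefect m x b c z + t := by
  have h : ∀ i j, inner ℝ (b i) (b j) = if i = j then (1 : ℝ) else 0 :=
    orthonormal_iff_ite.1 b.orthonormal
  simp only [graphDefect, frameCoord_add_smul, h]
  simp
  ring

namespace HermiteData

/-- The local point lies on the graph of the fitted polynomial and keeps the `uv`-coordinates of
`x`, so its defect is the difference of two polynomials there. -/
theorem graphDefect_localPoint {M : TriMesh} (D : HermiteData M) {n : ℕ} (v : Fin M.numVerts)
    (c : MonoIdx (n + 1) → ℝ) (c' : ℕ → ℕ → ℝ) (x : E3) :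
    graphDefect (n + 1) (M.pos v) (D.frame v) c' (D.localPoint v c x) =
      ∑ a : MonoIdx (n + 1), (c a - c' a.1.1.val a.1.2.val) *
        frameCoord (M.pos v) (D.frame v) 0 x ^ a.1.1.val *
        frameCoord (M.pos v) (D.frame v) 1 x ^ a.1.2.val := by
  rw [localPoint_eq, graphDefect_add_smul_third, graphDefect, polyEval,
    ← sum_monoIdx (n + 1) fun j k => c' j k * frameCoord (M.pos v) (D.frame v) 0 x ^ j *
      frameCoord (M.pos v) (D.frame v) 1 x ^ k]
  simp only [sub_mul, Finset.sum_sub_distrib, evalPoly]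
  ring

/-- The hypotheses of the error estimate, apart from those on the individual fittings. -/
structure IsAccurate {M : TriMesh} (D : HermiteData M) (Γ K : Set E3) (n k₀ : ℕ) (C₀ ρ h : ℝ) :
    Prop where
  edge_le : ∀ T ∈ M.faces, ∀ v ∈ T, ∀ w ∈ T, dist (M.pos v) (M.pos w) ≤ ρ * h
  exists_near : ∀ v, ∃ y ∈ K, dist (M.pos v) y ≤ C₀ * h ^ (n + 2) ∧
    (∃ ν, IsUnitNormal Γ y ν ∧ ‖D.normal v - ν‖ ≤ C₀ * h ^ (n + 1)) ∧
    ∃ ν, IsUnitNormal Γ y ν ∧ ‖D.frame v 2 - ν‖ ≤ C₀ * h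
  stencil_subset : ∀ v, D.stencil v ⊆ M.ring k₀ v

/-- The stencil lies within `k₀ * ρ * h` of the vertex, so the row bounds apply with that radius;
the least-squares estimate turns them into coefficient bounds. -/
theorem exists_fit_bound (n : ℕ) (k₀ : ℕ) (r : ℝ≥0∞) [Fact (1 ≤ r)] {δ L C₀ ρ κ : ℝ} (hδ : 0 < δ)
    (hδ1 : δ ≤ 1) (hL : 1 ≤ L) (hC₀ : 0 ≤ C₀) (hρ : 0 ≤ ρ) (hκ : 0 ≤ κ) :
    ∃ C h₁ : ℝ, 0 ≤ C ∧ 0 < h₁ ∧ h₁ ≤ 1 ∧ ∀ (Γ K : Set E3) (M : TriMesh) (D : HermiteData M)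
      (h : ℝ), 0 < h → h ≤ h₁ → K ⊆ Γ → D.IsAccurate Γ K n k₀ C₀ ρ h → ∀ (v : Fin M.numVerts)
      (c : MonoIdx (n + 1) → ℝ) (c' : ℕ → ℕ → ℝ),
      IsWellConditioned r κ (D.weightMatrix v * D.rescaledMatrix (n + 1) h v) →
      D.IsFit h v c → IsGraphModel Γ n δ L (M.pos v) (D.frame v) c' →
      ∀ a : MonoIdx (n + 1),
        |c a - c' a.1.1.val a.1.2.val| * h ^ (a.1.1.val + a.1.2.val) ≤ C * h ^ (n + 2) := by
  obtain ⟨C, h₁, hC, hh₁, hrow⟩ := exists_row_bounds n hδ hδ1 hL hC₀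
    (by positivity : 0 ≤ k₀ * ρ)
  refine ⟨3 * κ * C, min h₁ 1, by positivity, lt_min hh₁ one_pos, min_le_right _ _, ?_⟩
  intro Γ K M D h h0 hh hKΓ hD v c c' hcond hfit hm a
  have key := D.abs_coeff_sub_le h0 r (c' := fun a => c' a.1.1.val a.1.2.val)
    (η := C * h ^ (n + 2)) hfit hcond (by positivity) ?_ a
  · rwa [mul_assoc _ C]
  · rintro ⟨k, i⟩
    obtain ⟨y, hy, hyi, ⟨ν, hν, hνi⟩, -⟩ := hD.exists_near i
    have hd := TriMesh.dist_le_of_mem_ring hD.edge_le (hD.stencil_subset v i.2)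
    rw [dist_eq_norm, ← mul_assoc] at hd
    rw [dist_eq_norm] at hyi
    obtain ⟨r1, r2, r3⟩ := hrow Γ (M.pos v) (D.frame v) c' hm h h0 (hh.trans (min_le_left _ _))
      (M.pos i) y (D.normal i) ν (hKΓ hy) hyi hd hν hνi
    have hmul : ∀ s : ℝ, |s| ≤ C * h ^ (n + 1) → |h * s| ≤ C * h ^ (n + 2) := by
      intro s hs
      rw [abs_mul, abs_of_pos h0, pow_succ h (n + 1), ← mul_assoc, mul_comm h]
      gcongr
    fin_cases k
    · change |(1 : ℝ) * (D.coord v (M.pos i) 2 -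
        (D.fitMatrix (n + 1) v).mulVec (fun a => c' a.1.1.val a.1.2.val) (0, i))| ≤ _
      rw [fitMatrix_mulVec_zero, one_mul, coord_eq, coord_eq, coord_eq]
      exact r1
    · change |h * (-((D.frame v).repr (D.normal i) 0 / (D.frame v).repr (D.normal i) 2) -
        (D.fitMatrix (n + 1) v).mulVec (fun a => c' a.1.1.val a.1.2.val) (1, i))| ≤ _
      rw [fitMatrix_mulVec_one, coord_eq, coord_eq, OrthonormalBasis.repr_apply_apply,
        OrthonormalBasis.repr_apply_apply]
      exact hmul _ r2
    · change |h * (-((D.frame v).repr (D.normal i) 1 / (D.frame v).repr (D.normal i) 2) -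
        (D.fitMatrix (n + 1) v).mulVec (fun a => c' a.1.1.val a.1.2.val) (2, i))| ≤ _
      rw [fitMatrix_mulVec_two, coord_eq, coord_eq, OrthonormalBasis.repr_apply_apply,
        OrthonormalBasis.repr_apply_apply]
      exact hmul _ r3

/-- The local fitting is accurate to order `n + 2` near its vertex. -/
theorem exists_localPoint_bound (n : ℕ) (k₀ : ℕ) (r : ℝ≥0∞) [Fact (1 ≤ r)] {δ L C₀ ρ κ : ℝ}
    (hδ : 0 < δ) (hδ1 : δ ≤ 1) (hL : 1 ≤ L) (hC₀ : 0 ≤ C₀) (hρ : 0 ≤ ρ) (hκ : 0 ≤ κ) :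
    ∃ C h₁ : ℝ, 0 ≤ C ∧ 0 < h₁ ∧ h₁ ≤ 1 ∧ ∀ (Γ K : Set E3) (M : TriMesh) (D : HermiteData M)
      (h : ℝ), 0 < h → h ≤ h₁ → K ⊆ Γ → D.IsAccurate Γ K n k₀ C₀ ρ h → ∀ (v : Fin M.numVerts)
      (c : MonoIdx (n + 1) → ℝ) (c' : ℕ → ℕ → ℝ),
      IsWellConditioned r κ (D.weightMatrix v * D.rescaledMatrix (n + 1) h v) →
      D.IsFit h v c → IsGraphModel Γ n δ L (M.pos v) (D.frame v) c' →
      ∀ x : E3, ‖x - M.pos v‖ ≤ ρ * h → ∃ t : ℝ, D.localPoint v c x = x + t • D.frame v 2 ∧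
        |t| ≤ C * h ∧ ∃ z ∈ Γ, ‖D.localPoint v c x - z‖ ≤ C * h ^ (n + 2) := by
  obtain ⟨C₁, h₁, hC₁, hh₁, hh₁1, hfit⟩ := exists_fit_bound n k₀ r hδ hδ1 hL hC₀ hρ hκ
  obtain ⟨N, hN, hlip⟩ := exists_abs_graphDefect_sub_le n
  -- The base `ρ + 1 ≥ 1` allows all the exponents `j + k` to be replaced by `n + 1`.
  set C₂ := (Fintype.card (MonoIdx (n + 1)) : ℝ) * (C₁ * (ρ + 1) ^ (n + 1)) with hC₂
  have hC₂0 : 0 ≤ C₂ := by positivity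
  set C₃ := C₂ + L * C₀ + N * L * (ρ + C₀) with hC₃
  have hC₃0 : 0 ≤ C₃ := by positivity
  set C₄ := C₂ + L * (ρ + C₃) ^ (n + 2) with hC₄
  have hC₄0 : 0 ≤ C₄ := by positivity
  obtain ⟨h₂, hh₂, hh₂1, hsmall⟩ := exists_forall_mul_le (by positivity : 0 ≤ ρ + C₀ + C₃) hδ
  refine ⟨C₃ + C₄, min h₁ h₂, by positivity, lt_min hh₁ hh₂, (min_le_left _ _).trans hh₁1, ?_⟩
  intro Γ K M D h h0 hh hKΓ hD v c c' hcond hc hm x hx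
  have hh1 : h ≤ 1 := (hh.trans (min_le_left _ _)).trans hh₁1
  have hsm := hsmall h (hh.trans (min_le_right _ _))
  have hdef : |graphDefect (n + 1) (M.pos v) (D.frame v) c' (D.localPoint v c x)| ≤
      C₂ * h ^ (n + 2) := by
    rw [graphDefect_localPoint]
    refine (Finset.abs_sum_le_sum_abs _ _).trans ?_
    calc _ ≤ ∑ _a : MonoIdx (n + 1), C₁ * (ρ + 1) ^ (n + 1) * h ^ (n + 2) := by
          refine Finset.sum_le_sum fun a _ => ?_
          have h1 := hfit Γ K M D h h0 (hh.trans (min_le_left _ _)) hKΓ hD v c c' hcond hc hm a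
          have hu : |frameCoord (M.pos v) (D.frame v) 0 x| ≤ (ρ + 1) * h :=
            (abs_inner_le_norm_of_basis _ 0 _).trans (hx.trans (by gcongr; linarith))
          have hv : |frameCoord (M.pos v) (D.frame v) 1 x| ≤ (ρ + 1) * h :=
            (abs_inner_le_norm_of_basis _ 1 _).trans (hx.trans (by gcongr; linarith))
          rw [abs_mul, abs_mul, abs_pow, abs_pow]
          calc _ ≤ |c a - c' a.1.1.val a.1.2.val| * ((ρ + 1) * h) ^ a.1.1.val *
                ((ρ + 1) * h) ^ a.1.2.val := by gcongr
            _ = (|c a - c' a.1.1.val a.1.2.val| * h ^ (a.1.1.val + a.1.2.val)) *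
                (ρ + 1) ^ (a.1.1.val + a.1.2.val) := by
                rw [mul_pow, mul_pow, pow_add, pow_add]; ring
            _ ≤ (C₁ * h ^ (n + 2)) * (ρ + 1) ^ (n + 1) := by
                have h2 : (ρ + 1) ^ (a.1.1.val + a.1.2.val) ≤ (ρ + 1) ^ (n + 1) :=
                  pow_le_pow_right₀ (by linarith) a.2
                gcongr
            _ = _ := by ring
      _ = _ := by
          rw [Finset.sum_const, Finset.card_univ, nsmul_eq_mul, hC₂]; ring
  set t := evalPoly c (frameCoord (M.pos v) (D.frame v) 0 x)
      (frameCoord (M.pos v) (D.frame v) 1 x) - frameCoord (M.pos v) (D.frame v) 2 x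
  have hq : D.localPoint v c x = x + t • D.frame v 2 := D.localPoint_eq v c x
  have hpow : h ^ (n + 2) ≤ h := pow_succ_le_self h0.le hh1 (n + 1)
  -- A crude bound, from the difference of the defects of the local point and of `x`; it only keeps
  -- the points in range of the model. The order h^2 comes with the averaging.
  have ht : |t| ≤ C₃ * h := by
    have h1 := graphDefect_add_smul_third (m := n + 1) (M.pos v) (D.frame v) c' x t
    rw [← hq] at h1
    obtain ⟨y, hy, hyv, -⟩ := hD.exists_near v
    rw [dist_eq_norm, norm_sub_rev] at hyv
    have hyv' : ‖y - M.pos v‖ ≤ C₀ * h := hyv.trans (by gcongr)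
    have hyδ : ‖y - M.pos v‖ ≤ δ := hyv'.trans (le_trans (by gcongr; linarith) hsm)
    have hxδ : ‖x - M.pos v‖ ≤ δ := hx.trans (le_trans (by gcongr; linarith) hsm)
    have h2 := hlip (M.pos v) (D.frame v) c' L hm.coeffBound hL x y (hxδ.trans hδ1)
      (hyδ.trans hδ1)
    have h3 : |graphDefect (n + 1) (M.pos v) (D.frame v) c' y| ≤ L * ‖y - M.pos v‖ ^ (n + 2) :=
      hm.height y (hKΓ hy) hyδ
    have h4 : ‖y - M.pos v‖ ^ (n + 2) ≤ C₀ * h :=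
      (pow_succ_le_self (norm_nonneg _) (hyδ.trans hδ1) (n + 1)).trans hyv'
    have h5 : L * ‖y - M.pos v‖ ^ (n + 2) ≤ L * (C₀ * h) := by gcongr
    have h6 : ‖x - y‖ ≤ (ρ + C₀) * h := by
      have := norm_sub_le (x - M.pos v) (y - M.pos v)
      rw [sub_sub_sub_cancel_right] at this
      linarith
    have h7 : N * L * ‖x - y‖ ≤ N * L * ((ρ + C₀) * h) := by gcongr
    have h8 := abs_sub_abs_le_abs_sub (graphDefect (n + 1) (M.pos v) (D.frame v) c' x)
      (graphDefect (n + 1) (M.pos v) (D.frame v) c' y)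
    have h9 : C₂ * h ^ (n + 2) ≤ C₂ * h := by gcongr
    have h10 : t = graphDefect (n + 1) (M.pos v) (D.frame v) c' (D.localPoint v c x) -
      graphDefect (n + 1) (M.pos v) (D.frame v) c' x := by rw [h1]; ring
    have h11 := abs_sub (graphDefect (n + 1) (M.pos v) (D.frame v) c' (D.localPoint v c x))
      (graphDefect (n + 1) (M.pos v) (D.frame v) c' x)
    rw [← h10] at h11
    have h12 : C₃ * h = C₂ * h + L * (C₀ * h) + N * L * ((ρ + C₀) * h) := by rw [hC₃]; ring
    linarith
  have hqx : ‖D.localPoint v c x - M.pos v‖ ≤ (ρ + C₃) * h := by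
    have e : D.localPoint v c x - M.pos v = (x - M.pos v) + t • D.frame v 2 := by rw [hq]; abel
    rw [e]
    refine (norm_add_le _ _).trans ?_
    rw [norm_smul, (D.frame v).norm_eq_one, mul_one, Real.norm_eq_abs]
    linarith
  refine ⟨t, hq, ht.trans (by gcongr; linarith), ?_⟩
  obtain ⟨z, hz, hqz⟩ := hm.exists_norm_sub_le (hqx.trans (le_trans (by gcongr; linarith) hsm))
  refine ⟨z, hz, hqz.trans ?_⟩
  have h1 : L * ‖D.localPoint v c x - M.pos v‖ ^ (n + 2) ≤
      L * (ρ + C₃) ^ (n + 2) * h ^ (n + 2) := by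
    rw [mul_assoc, ← mul_pow]; gcongr
  have h2 : 0 ≤ C₃ * h ^ (n + 2) := by positivity
  have h3 : (C₃ + C₄) * h ^ (n + 2) =
      C₃ * h ^ (n + 2) + C₂ * h ^ (n + 2) + L * (ρ + C₃) ^ (n + 2) * h ^ (n + 2) := by
    rw [hC₄]; ring
  linarith

end HermiteData

/-! ### Averages of local reconstructions -/

/-- If the third axis of the frame is close to the normal at a point near the origin, then normals
at nearby points have small components along the first two axes. -/
theorem exists_tilt_bound (n : ℕ) {δ L C₀ R : ℝ} (hδ : 0 < δ) (hδ1 : δ ≤ 1) (hL : 1 ≤ L)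
    (hC₀ : 0 ≤ C₀) (hR : 0 ≤ R) : ∃ C h₁ : ℝ, 0 ≤ C ∧ 0 < h₁ ∧
    ∀ (Γ : Set E3) (x : E3) (b : OrthonormalBasis (Fin 3) ℝ E3) (c : ℕ → ℕ → ℝ),
      IsGraphModel Γ n δ L x b c → ∀ h, 0 < h → h ≤ h₁ → ∀ y₀ ν₀ y ν m : E3, y₀ ∈ Γ →
      ‖y₀ - x‖ ≤ C₀ * h → IsUnitNormal Γ y₀ ν₀ → ‖b 2 - ν₀‖ ≤ C₀ * h → y ∈ Γ → ‖y - x‖ ≤ R * h →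
      IsUnitNormal Γ y ν → ‖m - ν‖ ≤ C₀ * h →
      |inner ℝ (b 0) m| ≤ C * h ∧ |inner ℝ (b 1) m| ≤ C * h ∧ 1 ≤ 2 * L * |inner ℝ (b 2) m| := by
  obtain ⟨N, hN, hlip⟩ := exists_abs_polyEval_sub_le n
  set L' := (n + 1) * L with hL'
  have hL'0 : 0 ≤ L' := by positivity
  set C := L * (L * C₀ + C₀) + N * L' * (R + C₀) + L * R + C₀ with hC
  obtain ⟨h₁, hh₁, hh₁1, hsmall₁⟩ := exists_forall_mul_le (by positivity : 0 ≤ R + C₀) hδ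
  obtain ⟨h₂, hh₂, hh₂1, hsmall₂⟩ := exists_forall_mul_le (by positivity : 0 ≤ L * C₀)
    (by norm_num : (0 : ℝ) < 1 / 2)
  refine ⟨C, min h₁ h₂, by positivity, lt_min hh₁ hh₂, ?_⟩
  intro Γ x b c hm h h0 hh y₀ ν₀ y ν m hy₀ hyx₀ hν₀ hb hy hyx hν hmν
  have hsm := hsmall₁ h (hh.trans (min_le_left _ _))
  have hsm2 := hsmall₂ h (hh.trans (min_le_right _ _))
  have hyδ₀ : ‖y₀ - x‖ ≤ δ := hyx₀.trans (le_trans (by gcongr; linarith) hsm)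
  have hyδ : ‖y - x‖ ≤ δ := hyx.trans (le_trans (by gcongr; linarith) hsm)
  have hmi : ∀ i, |inner ℝ (b i) m - inner ℝ (b i) ν| ≤ C₀ * h := fun i => by
    rw [← inner_sub_right]
    exact (abs_inner_le_norm_of_basis b i _).trans hmν
  have main : ∀ (i : Fin 3) (c' : ℕ → ℕ → ℝ), i ≠ 2 → CoeffBound n c' L' →
      (∀ z ∈ Γ, ‖z - x‖ ≤ δ → ∀ ν, IsUnitNormal Γ z ν →
        |inner ℝ (b i) ν + polyEval n c' (frameCoord x b 0 z) (frameCoord x b 1 z) *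
          inner ℝ (b 2) ν| ≤ L * ‖z - x‖ ^ (n + 1)) →
      |inner ℝ (b i) m| ≤ C * h := by
    intro i c' hi hc' hnormal
    set P₀ := polyEval n c' (frameCoord x b 0 y₀) (frameCoord x b 1 y₀)
    set P := polyEval n c' (frameCoord x b 0 y) (frameCoord x b 1 y)
    -- Since `b i` is orthogonal to `b 2`, it is nearly orthogonal to `ν₀`, so the graph has slope
    -- O(h) at `y₀`, then at `y`. Passing through slopes avoids comparing the signs of `ν₀` and `ν`.
    have e1 : |inner ℝ (b i) ν₀| ≤ C₀ * h := by
      have h1 : inner ℝ (b i) ν₀ = -inner ℝ (b i) (b 2 - ν₀) := by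
        rw [inner_sub_right, b.orthonormal.inner_eq_zero hi]; ring
      rw [h1, abs_neg]
      exact (abs_inner_le_norm_of_basis b i _).trans hb
    have e2 : |P₀ * inner ℝ (b 2) ν₀| ≤ (L * C₀ + C₀) * h := by
      have h1 := hnormal y₀ hy₀ hyδ₀ ν₀ hν₀
      have h2 : ‖y₀ - x‖ ^ (n + 1) ≤ C₀ * h :=
        (pow_succ_le_self (norm_nonneg _) (hyδ₀.trans hδ1) n).trans hyx₀
      have h3 : L * ‖y₀ - x‖ ^ (n + 1) ≤ L * (C₀ * h) := by gcongr
      have h4 := abs_sub (inner ℝ (b i) ν₀ + P₀ * inner ℝ (b 2) ν₀) (inner ℝ (b i) ν₀)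
      rw [add_sub_cancel_left] at h4
      linarith
    have e3 : |P₀| ≤ L * ((L * C₀ + C₀) * h) := by
      have h1 := hm.normal_ne y₀ hy₀ hyδ₀ ν₀ hν₀
      rw [abs_mul] at e2
      calc |P₀| = |P₀| * 1 := by ring
        _ ≤ |P₀| * (L * |inner ℝ (b 2) ν₀|) := by gcongr
        _ = L * (|P₀| * |inner ℝ (b 2) ν₀|) := by ring
        _ ≤ _ := by gcongr
    have e4 : |P - P₀| ≤ N * L' * ((R + C₀) * h) := by
      refine (hlip c' L' hc' (planeCoord x b y₀) (planeCoord x b y)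
        ((norm_planeCoord_le x b y₀).trans (hyδ₀.trans hδ1))
        ((norm_planeCoord_le x b y).trans (hyδ.trans hδ1))).trans ?_
      have h1 := norm_sub_le (y - x) (y₀ - x)
      rw [sub_sub_sub_cancel_right] at h1
      have h2 := (norm_planeCoord_sub_le x b y y₀).trans h1
      gcongr
      linarith
    have e5 : |inner ℝ (b i) ν| ≤ |P| + L * (R * h) := by
      have h1 := hnormal y hy hyδ ν hν
      have h2 : ‖y - x‖ ^ (n + 1) ≤ R * h :=
        (pow_succ_le_self (norm_nonneg _) (hyδ.trans hδ1) n).trans hyx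
      have h3 : L * ‖y - x‖ ^ (n + 1) ≤ L * (R * h) := by gcongr
      have h4 := abs_sub (inner ℝ (b i) ν + P * inner ℝ (b 2) ν) (P * inner ℝ (b 2) ν)
      rw [add_sub_cancel_right, abs_mul P] at h4
      have h5 : |P| * |inner ℝ (b 2) ν| ≤ |P| :=
        mul_le_of_le_one_right (abs_nonneg _) (hν.1 ▸ abs_inner_le_norm_of_basis b 2 ν)
      linarith
    have e6 := abs_sub_abs_le_abs_sub P P₀
    have e7 := abs_sub_abs_le_abs_sub (inner ℝ (b i) m) (inner ℝ (b i) ν)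
    have e8 := hmi i
    have e9 : C * h = L * ((L * C₀ + C₀) * h) + N * L' * ((R + C₀) * h) + L * (R * h) + C₀ * h := by
      rw [hC]; ring
    linarith
  refine ⟨main 0 _ (by decide) hm.coeffBound.left hm.normal_left,
    main 1 _ (by decide) hm.coeffBound.right hm.normal_right, ?_⟩
  have h1 := hm.normal_ne y hy hyδ ν hν
  have h2 := abs_sub_abs_le_abs_sub (inner ℝ (b 2) ν) (inner ℝ (b 2) m)
  rw [abs_sub_comm] at h2
  have h3 := hmi 2
  have h4 : L * |inner ℝ (b 2) ν| ≤ L * (|inner ℝ (b 2) m| + C₀ * h) := by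
    gcongr; linarith
  linarith

theorem norm_le_of_basis (b : OrthonormalBasis (Fin 3) ℝ E3) (z : E3) :
    ‖z‖ ≤ |(inner ℝ (b 0) z : ℝ)| + |(inner ℝ (b 1) z : ℝ)| + |(inner ℝ (b 2) z : ℝ)| := by
  nth_rw 1 [← sum_inner_smul_add b z]
  refine norm_add₃_le.trans ?_
  simp [norm_smul]

/-- Points of the lines through `X` in nearly normal directions at which the defect is small are
close to each other. -/
theorem norm_add_smul_sub_le (n : ℕ) {L N A B h ε : ℝ} (hh : 0 ≤ h) (hL : 1 ≤ L) (hA : 0 ≤ A)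
    (hN : 0 ≤ N) {x X m : E3} {b : OrthonormalBasis (Fin 3) ℝ E3} {c : ℕ → ℕ → ℝ} {t : ℝ}
    (hlip : ∀ w w' : ℝ × ℝ, ‖w‖ ≤ 1 → ‖w'‖ ≤ 1 →
      |polyEval (n + 1) c w'.1 w'.2 - polyEval (n + 1) c w.1 w.2| ≤ N * ‖w' - w‖)
    (h0 : |inner ℝ (b 0) m| ≤ A * h) (h1 : |inner ℝ (b 1) m| ≤ A * h)
    (h2 : 1 ≤ 2 * L * |inner ℝ (b 2) m|) (hX : ‖X - x‖ ≤ 1) (hq : ‖X + t • m - x‖ ≤ 1)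
    (hdX : |graphDefect (n + 1) x b c X| ≤ B * h ^ 2)
    (hdq : |graphDefect (n + 1) x b c (X + t • m)| ≤ ε) (hεB : ε ≤ B * h ^ 2)
    (hsmall : 4 * L * N * A * h ≤ 1) :
    ‖X + t • m - (X - graphDefect (n + 1) x b c X • b 2)‖ ≤
      ε + 8 * L * B * A * (N + 2) * h ^ 3 := by
  set H := graphDefect (n + 1) x b c X with hH
  set γ := inner ℝ (b 2) m with hγ
  have hP : |polyEval (n + 1) c (frameCoord x b 0 (X + t • m)) (frameCoord x b 1 (X + t • m)) -
      polyEval (n + 1) c (frameCoord x b 0 X) (frameCoord x b 1 X)| ≤ N * (|t| * (A * h)) := by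
    refine (hlip (planeCoord x b X) (planeCoord x b (X + t • m))
      ((norm_planeCoord_le x b X).trans hX) ((norm_planeCoord_le x b _).trans hq)).trans ?_
    rw [planeCoord_sub, add_sub_cancel_left]
    gcongr
    refine max_le ?_ ?_
    · rw [inner_smul_right, norm_mul, Real.norm_eq_abs, Real.norm_eq_abs]
      gcongr
    · change ‖inner ℝ (b 1) (t • m)‖ ≤ _
      rw [inner_smul_right, norm_mul, Real.norm_eq_abs, Real.norm_eq_abs]
      gcongr
  -- The step `t • m` raises the height by `t * γ`, which must cancel the defect of `X` up to the
  -- defect left over and the change of the polynomial under the sideways shift.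
  have hsum : |t * γ + H| ≤ ε + N * (|t| * (A * h)) := by
    have e : t * γ + H = graphDefect (n + 1) x b c (X + t • m) +
        (polyEval (n + 1) c (frameCoord x b 0 (X + t • m)) (frameCoord x b 1 (X + t • m)) -
          polyEval (n + 1) c (frameCoord x b 0 X) (frameCoord x b 1 X)) := by
      rw [hH, graphDefect, graphDefect, frameCoord_add_smul x b 2]
      ring
    rw [e]
    exact (abs_add_le _ _).trans (add_le_add hdq hP)
  -- By `hsmall` the term with |t| on the right is at most |t|/2 and is absorbed.
  have ht : |t| ≤ 8 * L * B * h ^ 2 := by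
    have e1 : |t| ≤ 2 * L * |t * γ| := by
      rw [abs_mul]
      calc |t| = |t| * 1 := by ring
        _ ≤ |t| * (2 * L * |γ|) := by gcongr
        _ = _ := by ring
    have e2 := abs_sub (t * γ + H) H
    rw [add_sub_cancel_right] at e2
    have e3 : |t * γ| ≤ 2 * (B * h ^ 2) + N * (|t| * (A * h)) := by linarith
    have e4 : 2 * L * |t * γ| ≤ 2 * L * (2 * (B * h ^ 2) + N * (|t| * (A * h))) := by gcongr
    have e5 : 4 * L * N * A * h * |t| ≤ 1 * |t| := by gcongr
    linarith
  -- Two sideways components |t|Ah and the vertical one bounded by `hsum` account for the factor `N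
  -- + 2`.
  refine (norm_le_of_basis b _).trans ?_
  have hdiff : X + t • m - (X - H • b 2) = t • m + H • b 2 := by abel
  have hort : ∀ i j, inner ℝ (b i) (b j) = if i = j then (1 : ℝ) else 0 :=
    orthonormal_iff_ite.1 b.orthonormal
  rw [hdiff]
  simp only [inner_add_right, inner_smul_right, hort]
  simp only [Fin.reduceEq, if_false, if_true, mul_zero, mul_one, add_zero, abs_mul t]
  have k0 : |t| * |inner ℝ (b 0) m| ≤ |t| * (A * h) := by gcongr
  have k1 : |t| * |inner ℝ (b 1) m| ≤ |t| * (A * h) := by gcongr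
  have k2 : |t| * (A * h) * (N + 2) ≤ 8 * L * B * h ^ 2 * (A * h) * (N + 2) := by gcongr
  have k3 : 8 * L * B * h ^ 2 * (A * h) * (N + 2) = 8 * L * B * A * (N + 2) * h ^ 3 := by ring
  linarith

/-- All points are measured in the model of a single vertex `x`. The defect is affine up to the
square of the diameter. This is used twice: for the vertices `z i`, to bound the defect of `X` by
h^2, and for the points `q i`, whose diameter is by then only O(h^(n+2) + h^3). -/
theorem exists_average_bound (n : ℕ) {δ L C₀ R : ℝ} (hδ : 0 < δ) (hδ1 : δ ≤ 1) (hL : 1 ≤ L)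
    (hC₀ : 0 ≤ C₀) (hR : 0 ≤ R) : ∃ C h₁ : ℝ, 0 ≤ C ∧ 0 < h₁ ∧
    ∀ (Γ : Set E3) (x : E3) (b : OrthonormalBasis (Fin 3) ℝ E3) (c : ℕ → ℕ → ℝ),
      IsGraphModel Γ n δ L x b c → ∀ h, 0 < h → h ≤ h₁ → ∀ y₀ ν₀ : E3, y₀ ∈ Γ →
      ‖y₀ - x‖ ≤ C₀ * h → IsUnitNormal Γ y₀ ν₀ → ‖b 2 - ν₀‖ ≤ C₀ * h →
      ∀ {ι : Type} (T : Finset ι) (ξ t : ι → ℝ) (z m q : ι → E3), (∀ i ∈ T, 0 ≤ ξ i) →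
      ∑ i ∈ T, ξ i = 1 → (∀ i ∈ T, ∀ j ∈ T, ‖z i - z j‖ ≤ R * h) → (∀ i ∈ T, ‖z i - x‖ ≤ R * h) →
      (∀ i ∈ T, ‖m i‖ = 1) →
      (∀ i ∈ T, ∃ y ∈ Γ, ‖z i - y‖ ≤ C₀ * h ^ (n + 2) ∧
        ∃ ν, IsUnitNormal Γ y ν ∧ ‖m i - ν‖ ≤ C₀ * h) →
      (∀ i ∈ T, q i = ∑ j ∈ T, ξ j • z j + t i • m i) → (∀ i ∈ T, |t i| ≤ C₀ * h) →
      (∀ i ∈ T, ∃ y ∈ Γ, ‖q i - y‖ ≤ C₀ * h ^ (n + 2)) →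
      ‖∑ i ∈ T, ξ i • q i - x‖ ≤ C * h ∧
      ∃ y ∈ Γ, ‖∑ i ∈ T, ξ i • q i - y‖ ≤ C * (h ^ (n + 2) + h ^ 6) := by
  obtain ⟨N, hN, hlip⟩ := exists_abs_graphDefect_sub_le n
  obtain ⟨N', hN', hconv⟩ := exists_abs_graphDefect_sum_le n
  obtain ⟨N₁, hN₁, hpoly⟩ := exists_abs_polyEval_sub_le (n + 1)
  obtain ⟨A, h₁, hA, hh₁, htilt⟩ := exists_tilt_bound n hδ hδ1 hL hC₀ (by positivity : 0 ≤ R + C₀)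
  -- One `C₀` is for the distance from `X` to `q i`, the other for the distance from there to Γ.
  set R' := R + 2 * C₀ with hR'
  have hR'0 : 0 ≤ R' := by positivity
  obtain ⟨h₂, hh₂, hh₂1, hsmall₂⟩ := exists_forall_mul_le hR'0 hδ
  obtain ⟨h₃, hh₃, hh₃1, hsmall₃⟩ := exists_forall_mul_le
    (by positivity : 0 ≤ 4 * L * (N₁ * L) * A) one_pos
  set C₁ := L * R' ^ (n + 2) + N * L * C₀ with hC₁
  have hC₁0 : 0 ≤ C₁ := by positivity
  set B := C₁ + N' * L * R ^ 2 with hB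
  have hB0 : 0 ≤ B := by positivity
  set C₂ := 8 * L * B * A * (N₁ * L + 2) with hC₂
  have hC₂0 : 0 ≤ C₂ := by positivity
  set S := C₁ + C₂ with hS
  have hS0 : 0 ≤ S := by positivity
  set C₃ := C₁ + N' * L * (8 * S ^ 2) + L * R' ^ (n + 2) with hC₃
  have hC₃0 : 0 ≤ C₃ := by positivity
  refine ⟨R' + C₃, min h₁ (min h₂ h₃), by positivity, by positivity, ?_⟩
  intro Γ x b c hm h h0 hh y₀ ν₀ hy₀ hyx₀ hν₀ hb ι T ξ t z m q hξ hξ1 hzz hzx hm1 hnear hq ht hqΓ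
  have hle₁ : h ≤ h₁ := hh.trans (min_le_left _ _)
  have hle₂ : h ≤ h₂ := (hh.trans (min_le_right _ _)).trans (min_le_left _ _)
  have hle₃ : h ≤ h₃ := (hh.trans (min_le_right _ _)).trans (min_le_right _ _)
  have hh1 : h ≤ 1 := hle₂.trans hh₂1
  have hsm := hsmall₂ h hle₂
  have hpow : h ^ (n + 2) ≤ h := pow_succ_le_self h0.le hh1 (n + 1)
  have hpow2 : h ^ (n + 2) ≤ h ^ 2 := pow_le_pow_of_le_one h0.le hh1 (by omega)
  have hR1 : R * h ≤ R' * h := by gcongr; linarith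
  have hR2 : (R + C₀) * h ≤ R' * h := by gcongr; linarith
  set H := graphDefect (n + 1) x b c with hH
  -- points close to the surface have small defects
  have hdefect : ∀ p y : E3, y ∈ Γ → ‖p - y‖ ≤ C₀ * h ^ (n + 2) → ‖p - x‖ ≤ (R + C₀) * h →
      |H p| ≤ C₁ * h ^ (n + 2) := by
    intro p y hy hpy hpx
    have hyx : ‖y - x‖ ≤ R' * h := by
      have h1 := norm_sub_le (p - x) (p - y)
      rw [sub_sub_sub_cancel_left] at h1
      have h2 : C₀ * h ^ (n + 2) ≤ C₀ * h := by gcongr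
      rw [hR']
      linarith
    have h1 := hlip x b c L hm.coeffBound hL p y ((hpx.trans hR2).trans (hsm.trans hδ1))
      (hyx.trans (hsm.trans hδ1))
    have h2 : |H y| ≤ L * ‖y - x‖ ^ (n + 2) := hm.height y hy (hyx.trans hsm)
    have h3 : L * ‖y - x‖ ^ (n + 2) ≤ L * R' ^ (n + 2) * h ^ (n + 2) := by
      rw [mul_assoc, ← mul_pow]; gcongr
    have h4 : N * L * ‖p - y‖ ≤ N * L * C₀ * h ^ (n + 2) := by
      rw [mul_assoc _ C₀]; gcongr
    have h5 := abs_sub_abs_le_abs_sub (H p) (H y)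
    have h6 : C₁ * h ^ (n + 2) = L * R' ^ (n + 2) * h ^ (n + 2) + N * L * C₀ * h ^ (n + 2) := by
      rw [hC₁]; ring
    linarith
  set X := ∑ j ∈ T, ξ j • z j with hX
  have hXx : ‖X - x‖ ≤ R * h := norm_sum_smul_sub_le hξ hξ1 hzx
  have hqx : ∀ i ∈ T, ‖q i - x‖ ≤ (R + C₀) * h := by
    intro i hi
    have e : q i - x = (X - x) + t i • m i := by rw [hq i hi]; abel
    rw [e]
    refine (norm_add_le _ _).trans ?_
    rw [norm_smul, hm1 i hi, mul_one, Real.norm_eq_abs]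
    have := ht i hi
    linarith
  have hHz : ∀ i ∈ T, |H (z i)| ≤ C₁ * h ^ (n + 2) := by
    intro i hi
    obtain ⟨y, hy, hzy, -⟩ := hnear i hi
    exact hdefect _ y hy hzy ((hzx i hi).trans (by gcongr; linarith))
  have hHq : ∀ i ∈ T, |H (q i)| ≤ C₁ * h ^ (n + 2) := by
    intro i hi
    obtain ⟨y, hy, hqy⟩ := hqΓ i hi
    exact hdefect _ y hy hqy (hqx i hi)
  have havg : ∀ f : ι → ℝ, (∀ i ∈ T, |f i| ≤ C₁ * h ^ (n + 2)) →
      |∑ i ∈ T, ξ i * f i| ≤ C₁ * h ^ (n + 2) := by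
    intro f hf
    simpa using norm_sum_smul_sub_le hξ hξ1 (z := f) (a := 0) (by simpa using hf)
  have hHX : |H X| ≤ B * h ^ 2 := by
    have h1 := hconv x b c L hm.coeffBound T ξ z (R * h) hξ hξ1
      (fun i hi => (hzx i hi).trans (hR1.trans (hsm.trans hδ1))) hzz
    have h2 := havg (fun i => H (z i)) hHz
    have h3 := abs_sub_abs_le_abs_sub (H X) (∑ i ∈ T, ξ i * H (z i))
    have h4 : C₁ * h ^ (n + 2) ≤ C₁ * h ^ 2 := by gcongr
    have h5 : B * h ^ 2 = C₁ * h ^ 2 + N' * L * (R * h) ^ 2 := by rw [hB]; ring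
    have h1' : |H X - ∑ i ∈ T, ξ i * H (z i)| ≤ N' * L * (R * h) ^ 2 := h1
    linarith
  -- the points `q i` are close to each other
  set s := S * (h ^ (n + 2) + h ^ 3) with hs
  have hclose : ∀ i ∈ T, ‖q i - (X - H X • b 2)‖ ≤ s := by
    intro i hi
    obtain ⟨y, hy, hzy, ν, hν, hmν⟩ := hnear i hi
    have hyx : ‖y - x‖ ≤ (R + C₀) * h := by
      have h1 := norm_sub_le (z i - x) (z i - y)
      rw [sub_sub_sub_cancel_left] at h1
      have h2 : C₀ * h ^ (n + 2) ≤ C₀ * h := by gcongr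
      have h3 := hzx i hi
      linarith
    obtain ⟨k0, k1, k2⟩ := htilt Γ x b c hm h h0 hle₁ y₀ ν₀ y ν (m i) hy₀ hyx₀ hν₀ hb hy hyx hν hmν
    have hqi := hqx i hi
    have hHqi := hHq i hi
    rw [hq i hi] at hqi hHqi ⊢
    have key := norm_add_smul_sub_le n (N := N₁ * L) (A := A) (B := B) (ε := C₁ * h ^ (n + 2)) h0.le
      hL hA (by positivity)
      (fun w w' hw hw' => hpoly c L hm.coeffBound w w' hw hw') k0 k1 k2
      (hXx.trans (hR1.trans (hsm.trans hδ1))) ((hqi.trans hR2).trans (hsm.trans hδ1)) hHX hHqi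
      (by
        have h4 : C₁ * h ^ (n + 2) ≤ C₁ * h ^ 2 := by gcongr
        have h5 : B * h ^ 2 = C₁ * h ^ 2 + N' * L * R ^ 2 * h ^ 2 := by rw [hB]; ring
        have h6 : 0 ≤ N' * L * R ^ 2 * h ^ 2 := by positivity
        linarith) (hsmall₃ h hle₃)
    refine key.trans ?_
    have e1 : 0 ≤ C₂ * h ^ (n + 2) := by positivity
    have e2 : 0 ≤ C₁ * h ^ 3 := by positivity
    have e3 : s = C₁ * h ^ (n + 2) + C₂ * h ^ (n + 2) + C₁ * h ^ 3 + C₂ * h ^ 3 := by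
      rw [hs, hS]; ring
    linarith
  have hqq : ∀ i ∈ T, ∀ j ∈ T, ‖q i - q j‖ ≤ 2 * s := by
    intro i hi j hj
    have h1 := norm_sub_le (q i - (X - H X • b 2)) (q j - (X - H X • b 2))
    rw [sub_sub_sub_cancel_right] at h1
    have h2 := hclose i hi
    have h3 := hclose j hj
    linarith
  set Q := ∑ i ∈ T, ξ i • q i with hQ
  have hQx : ‖Q - x‖ ≤ R' * h := norm_sum_smul_sub_le hξ hξ1 fun i hi => (hqx i hi).trans hR2
  have hHQ : |H Q| ≤ C₁ * h ^ (n + 2) + N' * L * (2 * s) ^ 2 := by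
    have h1 : |H Q - ∑ i ∈ T, ξ i * H (q i)| ≤ N' * L * (2 * s) ^ 2 :=
      hconv x b c L hm.coeffBound T ξ q (2 * s) hξ hξ1
        (fun i hi => ((hqx i hi).trans hR2).trans (hsm.trans hδ1)) hqq
    have h2 := havg (fun i => H (q i)) hHq
    have h3 := abs_sub_abs_le_abs_sub (H Q) (∑ i ∈ T, ξ i * H (q i))
    linarith
  -- Origin of the exponent 6: the sideways spread h^3 is squared, while the square of h^(n+2) is
  -- absorbed into h^(n+2).
  have hs2 : (2 * s) ^ 2 ≤ 8 * S ^ 2 * (h ^ (n + 2) + h ^ 6) := by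
    have e1 : (h ^ (n + 2) + h ^ 3) ^ 2 ≤ 2 * ((h ^ (n + 2)) ^ 2 + (h ^ 3) ^ 2) := by
      have := sq_nonneg (h ^ (n + 2) - h ^ 3)
      linarith
    have e2 : (h ^ (n + 2)) ^ 2 ≤ h ^ (n + 2) :=
      pow_le_of_le_one (by positivity) (pow_le_one₀ h0.le hh1) two_ne_zero
    have e3 : (h ^ 3) ^ 2 = h ^ 6 := by ring
    have e4 : (2 * s) ^ 2 = 4 * S ^ 2 * (h ^ (n + 2) + h ^ 3) ^ 2 := by rw [hs]; ring
    rw [e4]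
    calc 4 * S ^ 2 * (h ^ (n + 2) + h ^ 3) ^ 2
        ≤ 4 * S ^ 2 * (2 * (h ^ (n + 2) + h ^ 6)) := by
          gcongr
          refine e1.trans ?_
          rw [e3]
          gcongr
      _ = _ := by ring
  refine ⟨hQx.trans (by gcongr; linarith), ?_⟩
  obtain ⟨y, hy, hQy⟩ := hm.exists_norm_sub_le (hQx.trans hsm)
  refine ⟨y, hy, hQy.trans ?_⟩
  have h1 : L * ‖Q - x‖ ^ (n + 2) ≤ L * R' ^ (n + 2) * h ^ (n + 2) := by
    rw [mul_assoc, ← mul_pow]; gcongr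
  have h2 : N' * L * (2 * s) ^ 2 ≤ N' * L * (8 * S ^ 2 * (h ^ (n + 2) + h ^ 6)) := by gcongr
  have h3 : 0 ≤ R' * (h ^ (n + 2) + h ^ 6) := by positivity
  have h4 : 0 ≤ (C₁ + L * R' ^ (n + 2)) * h ^ 6 := by positivity
  have h5 : (R' + C₃) * (h ^ (n + 2) + h ^ 6) = R' * (h ^ (n + 2) + h ^ 6) +
      C₁ * h ^ (n + 2) + N' * L * (8 * S ^ 2 * (h ^ (n + 2) + h ^ 6)) +
      L * R' ^ (n + 2) * h ^ (n + 2) + (C₁ + L * R' ^ (n + 2)) * h ^ 6 := by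
    rw [hC₃]; ring
  linarith

/-! ### The estimate for the whole reconstruction -/

theorem exists_hwalfSurface_bound (n k₀ : ℕ) {Γ K : Set E3} (hΓ : IsRegularSurface (n + 2) Γ)
    (hK : IsCompact K) (hKΓ : K ⊆ Γ) (r : ℝ≥0∞) [Fact (1 ≤ r)] {C₀ ρ κ : ℝ} (hC₀ : 0 ≤ C₀)
    (hρ : 0 ≤ ρ) (hκ : 0 ≤ κ) :
    ∃ C h₀ : ℝ, 0 < h₀ ∧ ∀ (M : TriMesh) (D : HermiteData M) (h : ℝ), 0 < h → h ≤ h₀ →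
      D.IsAccurate Γ K n k₀ C₀ ρ h →
      (∀ v, IsWellConditioned r κ (D.weightMatrix v * D.rescaledMatrix (n + 1) h v)) →
      ∀ c : Fin M.numVerts → MonoIdx (n + 1) → ℝ, (∀ v, D.IsFit h v (c v)) →
        ∀ q ∈ D.hwalfSurface c,
          ∃ y ∈ Γ, dist q y = Metric.infDist q Γ ∧ dist q y ≤ C * (h ^ (n + 2) + h ^ 6) := by
  obtain ⟨δ', L', hδ', hmodel'⟩ := exists_uniform_isGraphModel hΓ hK hKΓ
  obtain ⟨δ'', hδ'', hcpt⟩ := exists_isCompact_inter_closedBall hΓ hK hKΓ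
  set δ := min δ' 1
  have hδ : 0 < δ := lt_min hδ' one_pos
  have hδ1 : δ ≤ 1 := min_le_right _ _
  set L := max L' 1
  have hL : 1 ≤ L := le_max_right _ _
  obtain ⟨C₁, h₁, hC₁, hh₁, hh₁1, hlocal⟩ :=
    HermiteData.exists_localPoint_bound n k₀ r hδ hδ1 hL hC₀ hρ hκ
  obtain ⟨C₂, h₂, hC₂, hh₂, havg⟩ := exists_average_bound n hδ hδ1 hL
    (by positivity : 0 ≤ C₀ + C₁) hρ
  -- The bound 1/2 is the deviation of the third axis from a normal that the uniform models
  -- tolerate.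
  obtain ⟨h₃, hh₃, -, hsmall₃⟩ := exists_forall_mul_le hC₀ (lt_min hδ' one_half_pos)
  obtain ⟨h₄, hh₄, -, hsmall₄⟩ := exists_forall_mul_le (by positivity : 0 ≤ C₂ + C₀)
    (half_pos hδ'')
  refine ⟨C₂, min (min h₁ h₂) (min h₃ h₄), by positivity, ?_⟩
  rintro M D h h0 hh hD hcond c hfit q ⟨T, hT, ξ, hξ, hξ1, rfl⟩
  have hle₁ : h ≤ h₁ := (hh.trans (min_le_left _ _)).trans (min_le_left _ _)
  have hle₂ : h ≤ h₂ := (hh.trans (min_le_left _ _)).trans (min_le_right _ _)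
  have hle₃ : h ≤ h₃ := (hh.trans (min_le_right _ _)).trans (min_le_left _ _)
  have hle₄ : h ≤ h₄ := (hh.trans (min_le_right _ _)).trans (min_le_right _ _)
  have hh1 : h ≤ 1 := hle₁.trans hh₁1
  have hpow : h ^ (n + 2) ≤ h := pow_succ_le_self h0.le hh1 (n + 1)
  have hpow1 : h ^ (n + 1) ≤ h := pow_succ_le_self h0.le hh1 n
  have hsm := hsmall₃ h hle₃
  have hmodel : ∀ v, ∃ c', IsGraphModel Γ n δ L (M.pos v) (D.frame v) c' := by
    intro v
    obtain ⟨y, hy, hvy, -, ν, hν, hbν⟩ := hD.exists_near v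
    obtain ⟨c', hc'⟩ := hmodel' y hy (M.pos v) (D.frame v)
      (hvy.trans (le_trans (by gcongr) (hsm.trans (min_le_left _ _))))
      ⟨ν, hν, hbν.trans (hsm.trans (min_le_right _ _))⟩
    exact ⟨c', hc'.mono (min_le_left _ _) (le_max_left _ _)⟩
  choose c' hc' using hmodel
  -- Any vertex of the triangle can carry the model in which the average is measured.
  obtain ⟨a, ha⟩ : T.Nonempty := Finset.card_pos.1 (by rw [M.card_face T hT]; norm_num)
  obtain ⟨y₀, hy₀, hay₀, -, ν₀, hν₀, hbν₀⟩ := hD.exists_near a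
  rw [dist_eq_norm] at hay₀
  have hedge : ∀ v ∈ T, ∀ w ∈ T, ‖M.pos v - M.pos w‖ ≤ ρ * h := fun v hv w hw => by
    rw [← dist_eq_norm]; exact hD.edge_le T hT v hv w hw
  set X := ∑ w ∈ T, ξ w • M.pos w with hX
  have hXv : ∀ v ∈ T, ‖X - M.pos v‖ ≤ ρ * h := fun v hv =>
    norm_sum_smul_sub_le hξ hξ1 fun w hw => hedge w hw v hv
  have hfitv : ∀ v, ∃ t : ℝ, v ∈ T → D.localPoint v (c v) X = X + t • D.frame v 2 ∧
      |t| ≤ C₁ * h ∧ ∃ z ∈ Γ, ‖D.localPoint v (c v) X - z‖ ≤ C₁ * h ^ (n + 2) := by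
    intro v
    by_cases hv : v ∈ T
    · obtain ⟨t, ht⟩ := hlocal Γ K M D h h0 hle₁ hKΓ hD v (c v) (c' v) (hcond v) (hfit v) (hc' v)
        X (hXv v hv)
      exact ⟨t, fun _ => ht⟩
    · exact ⟨0, fun h => absurd h hv⟩
  choose t ht using hfitv
  obtain ⟨hqa, y, hy, hqy⟩ := havg Γ (M.pos a) (D.frame a) (c' a) (hc' a) h h0 hle₂ y₀ ν₀ (hKΓ hy₀)
    (by
      rw [norm_sub_rev]
      refine hay₀.trans ?_
      gcongr
      linarith) hν₀ (hbν₀.trans (by gcongr; linarith))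
    T ξ t M.pos (fun v => D.frame v 2) (fun v => D.localPoint v (c v) X) hξ hξ1 hedge
    (fun v hv => hedge v hv a ha) (fun v _ => (D.frame v).norm_eq_one 2)
    (fun v _ => by
      obtain ⟨y, hy, hvy, -, ν, hν, hbν⟩ := hD.exists_near v
      rw [dist_eq_norm] at hvy
      exact ⟨y, hKΓ hy, hvy.trans (by gcongr; linarith), ν, hν, hbν.trans (by gcongr; linarith)⟩)
    (fun v hv => (ht v hv).1) (fun v hv => (ht v hv).2.1.trans (by gcongr; linarith))
    (fun v hv => by
      obtain ⟨z, hz, hqz⟩ := (ht v hv).2.2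
      exact ⟨z, hz, hqz.trans (by gcongr; linarith)⟩)
  set q := ∑ v ∈ T, ξ v • D.localPoint v (c v) X
  -- The point `q` is O(h) from `y₀`, hence in the region where a closest point of Γ exists.
  have hqy₀ : dist q y₀ ≤ δ'' / 2 := by
    rw [dist_eq_norm]
    have h1 := norm_add_le (q - M.pos a) (M.pos a - y₀)
    rw [sub_add_sub_cancel] at h1
    have h2 : C₀ * h ^ (n + 2) ≤ C₀ * h := by gcongr
    have h3 := hsmall₄ h hle₄
    linarith
  obtain ⟨y', hy', heq⟩ := exists_dist_eq_infDist_of_isCompact_inter (hcpt y₀ hy₀) (hKΓ hy₀)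
    hδ''.le hqy₀
  refine ⟨y', hy', heq, ?_⟩
  rw [heq]
  exact (Metric.infDist_le_dist_of_mem hy).trans (by rw [dist_eq_norm]; exact hqy)

end

theorem mainTheorem4 (p : ℕ) (hp : 1 ≤ p)
    (Γ K : Set E3) (hΓ : IsRegularSurface (p + 1) Γ) (hK : IsCompact K) (hKΓ : K ⊆ Γ)
    (r : ℝ≥0∞) [Fact (1 ≤ r)] (C₀ ρ κ : ℝ) (k₀ : ℕ) :
    ∃ C h₀ : ℝ, 0 < h₀ ∧
      ∀ (M : TriMesh) (D : HermiteData M) (h : ℝ), 0 < h → h ≤ h₀ →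
        -- the edges have length at most `ρ * h`
        (∀ T ∈ M.faces, ∀ v ∈ T, ∀ w ∈ T, dist (M.pos v) (M.pos w) ≤ ρ * h) →
        -- accuracy of the vertices, of the normals, and of the axes of the local frames
        (∀ v, ∃ y ∈ K, dist (M.pos v) y ≤ C₀ * h ^ (p + 1) ∧
          (∃ ν, IsUnitNormal Γ y ν ∧ ‖D.normal v - ν‖ ≤ C₀ * h ^ p) ∧
          (∃ ν, IsUnitNormal Γ y ν ∧ ‖D.frame v 2 - ν‖ ≤ C₀ * h)) →
        -- the stencils lie in rings of bounded size, and the weights are nonnegative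
        (∀ v, D.stencil v ⊆ M.ring k₀ v) →
        (∀ v i, 0 ≤ D.weight v i) →
        -- the weighted rescaled Vandermonde systems are well conditioned
        (∀ v, IsWellConditioned r κ (D.weightMatrix v * D.rescaledMatrix p h v)) →
        ∀ c : Fin M.numVerts → MonoIdx p → ℝ, (∀ v, D.IsFit h v (c v)) →
          ∀ q ∈ D.hwalfSurface c,
            ∃ y ∈ Γ, dist q y = Metric.infDist q Γ ∧ dist q y ≤ C * (h ^ (p + 1) + h ^ 6) := by
  -- With p = n + 1 the slope polynomials have degree n without truncated subtraction. The constants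
  -- may be negative, so their absolute values are used.
  obtain ⟨n, rfl⟩ : ∃ n, p = n + 1 := ⟨p - 1, by omega⟩
  obtain ⟨C, h₀, hh₀, key⟩ := exists_hwalfSurface_bound n k₀ hΓ hK hKΓ r (abs_nonneg C₀)
    (abs_nonneg ρ) (abs_nonneg κ)
  refine ⟨C, h₀, hh₀, fun M D h h0 hh hedge hnear hstencil _ hcond c hfit q hq =>
    key M D h h0 hh ⟨fun T hT v hv w hw => ?_, fun v => ?_, hstencil⟩ (fun v => ?_) c hfit q hq⟩
  · refine (hedge T hT v hv w hw).trans ?_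
    gcongr
    exact le_abs_self ρ
  · obtain ⟨y, hy, h1, ⟨ν, hν, h2⟩, ν', hν', h3⟩ := hnear v
    refine ⟨y, hy, h1.trans ?_, ⟨ν, hν, h2.trans ?_⟩, ν', hν', h3.trans ?_⟩ <;>
    · gcongr
      exact le_abs_self C₀
  · exact ⟨(hcond v).1, (hcond v).2.trans (le_abs_self κ)⟩
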